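/- Let $(W,S)$ be a Coxeter system with $W$ finite and $|S|=m$. For $J\subseteq S$ let $\langle J\rangle$ be the subgroup generated by $J$, and for $-1\le r\le m$ let $$C_W(r)=\operatorname{span}_{\mathbb F_2}\{\mathbb 1_{\sigma\langle J\rangle} : \sigma\in W,\ J\subseteq S,\ |J|=m-r\}\subseteq \mathbb F_2^{W}$$ be the order-$r$ Coxeter code. For $w\in W$ let $d(w)=|\{s\in S:\ell(ws)<\ell(w)\}|$ be its descent number, and let $\varepsilon(W,i)=|\{w\in W: d(w)=i\}|$ be the $W$-Eulerian numbers. For binary linear codes $C_1,C_2$ of length $n$ with $C_1^\perp\subseteq C_2$, let $\mathrm{CSS}(C_1,C_2)$ be the $n$-qubit stabilizer code whose stabilizer group is generated by the Pauli operators $X^x$ ($x\in C_1^\perp$) and $Z^z$ ($z\in C_2^\perp$). It has parameters $[[n,k]]$ if its code space, the joint $+1$ eigenspace of the stabilizers in $(\mathbb C^2)^{\otimes n}$, has dimension $2^k$; its distance is the minimum weight of a Pauli operator that commutes with all stabilizers but is not a scalar multiple of a stabilizer. Let $-1\le q\le r\le m$. Then $C_W(m-q-1)^\perp\subseteq C_W(r)$,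 and the quantum Coxeter code $Q_W(q,r)=\mathrm{CSS}(C_W(m-q-1),C_W(r))$ is a stabilizer code with parameters $$\Big[\Big[\,n=|W|,\ k=\sum_{i=q+1}^{r}\varepsilon(W,i)\,\Big]\Big].$$ If moreover $q<r$ (so that the distance is defined), its distance is $d=2^{\min(q+1,\,m-r)}$. -/

import Mathlib

open scoped Pointwise

namespace QCoxeter

/-! ### Coxeter codes -/

section Coxeter

variable {B W : Type*} [Group W] {M : CoxeterMatrix B}

/-- The standard subgroup `⟨J⟩` generated by the simple reflections indexed by `J`. -/
def standardSubgroup (cs : CoxeterSystem M W) (J : Finset B) : Subgroup W :=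
  Subgroup.closure (cs.simple '' (J : Set B))

/-- The order-`r` Coxeter code: the span over `𝔽₂` of the indicator functions of the left cosets
`σ⟨J⟩` with `|J| = m - r`, where `m = |B|` is the rank of the system. -/
noncomputable def coxeterCode [Fintype B] (cs : CoxeterSystem M W) (r : ℤ) :
    Submodule (ZMod 2) (W → ZMod 2) :=
  Submodule.span (ZMod 2)
    {f | ∃ (σ : W) (J : Finset B), (J.card : ℤ) = (Fintype.card B : ℤ) - r ∧
      f = Set.indicator (σ • (standardSubgroup cs J : Set W)) 1}

/-- The (right) descent number of `w`. -/
noncomputable def descentNumber (cs : CoxeterSystem M W) (w : W) : ℕ :=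
  {i : B | cs.IsRightDescent w i}.ncard

/-- The `W`-Eulerian number: how many elements of `W` have descent number `i`. -/
noncomputable def eulerian (cs : CoxeterSystem M W) (i : ℕ) : ℕ :=
  {w : W | descentNumber cs w = i}.ncard

end Coxeter

/-! ### Stabilizer codes and CSS codes on qubits indexed by a finite type `ι` -/

section Quantum

variable {ι : Type*} [Fintype ι]

/-- The dual of a binary linear code with respect to the standard dot product. -/
def dualCode (C : Submodule (ZMod 2) (ι → ZMod 2)) : Submodule (ZMod 2) (ι → ZMod 2) where
  carrier := {y | ∀ x ∈ C, x ⬝ᵥ y = 0}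
  zero_mem' := fun x _ => dotProduct_zero x
  add_mem' := by
    intro a b ha hb x hx
    rw [dotProduct_add, ha x hx, hb x hx, add_zero]
  smul_mem' := by
    intro c a ha x hx
    rw [dotProduct_smul, ha x hx, smul_zero]

/-- Operators on `(ℂ²)^{⊗ι}`, as matrices in the computational basis `ι → Fin 2`. -/
abbrev Op (ι : Type*) : Type _ := Matrix (ι → Fin 2) (ι → Fin 2) ℂ

/-- The tensor (Kronecker) product `⨂ i, A i` of single-qubit operators. -/
def tensorOp (A : ι → Matrix (Fin 2) (Fin 2) ℂ) : Op ι :=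
  Matrix.of fun a b => ∏ i, A i (a i) (b i)

/-- The Pauli matrix `X`. -/
def pauliX : Matrix (Fin 2) (Fin 2) ℂ := !![0, 1; 1, 0]

/-- The Pauli matrix `Z`. -/
def pauliZ : Matrix (Fin 2) (Fin 2) ℂ := !![1, 0; 0, -1]

/-- `X^x = ⨂ i, X^{x_i}`. -/
def xOp (x : ι → ZMod 2) : Op ι := tensorOp fun i => pauliX ^ (x i).val

/-- `Z^z = ⨂ i, Z^{z_i}`. -/
def zOp (z : ι → ZMod 2) : Op ι := tensorOp fun i => pauliZ ^ (z i).val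

/-- The number of qubits on which `X^x Z^z` does not act as a multiple of the identity. -/
def pauliWeight (x z : ι → ZMod 2) : ℕ :=
  (Finset.univ.filter fun i => x i ≠ 0 ∨ z i ≠ 0).card

variable [DecidableEq ι]

/-- The Pauli operator `X^x Z^z`; up to a phase, every `n`-qubit Pauli operator is of this form. -/
def pauli (x z : ι → ZMod 2) : Op ι := xOp x * zOp z

/-- `S` is a stabilizer group: a commutative set of Pauli operators, closed under products, that
does not contain `-1`. (Such a submonoid is a group, as Pauli operators have finite order.) -/
structure IsStabilizerGroup (S : Submonoid (Op ι)) : Prop where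
  isPauli : ∀ s ∈ S, ∃ (c : ℂ) (x z : ι → ZMod 2), c ^ 4 = 1 ∧ s = c • pauli x z
  commute : ∀ s ∈ S, ∀ t ∈ S, Commute s t
  neg_one_notMem : (-1 : Op ι) ∉ S

/-- The code space stabilized by `S`: the joint `+1` eigenspace of the elements of `S`. -/
def codeSpace (S : Submonoid (Op ι)) : Submodule ℂ ((ι → Fin 2) → ℂ) where
  carrier := {ψ | ∀ s ∈ S, Matrix.mulVec s ψ = ψ}
  zero_mem' := fun s _ => Matrix.mulVec_zero s
  add_mem' := by
    intro a b ha hb s hs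
    rw [Matrix.mulVec_add, ha s hs, hb s hs]
  smul_mem' := by
    intro c a ha s hs
    rw [Matrix.mulVec_smul, ha s hs]

/-- The weights of the nontrivial logical Pauli operators of `S`: the Pauli operators that commute
with every stabilizer and are not, up to a scalar, stabilizers themselves. -/
def logicalWeights (S : Submonoid (Op ι)) : Set ℕ :=
  {w | ∃ x z : ι → ZMod 2, (∀ s ∈ S, Commute s (pauli x z)) ∧
    (∀ c : ℂ, c • pauli x z ∉ S) ∧ w = pauliWeight x z}

/-- `S` defines an `[[n, k]]` stabilizer code: `n` physical qubits, `k` logical qubits. -/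
structure IsCode (S : Submonoid (Op ι)) (n k : ℕ) : Prop where
  isStabilizerGroup : IsStabilizerGroup S
  length_eq : Fintype.card ι = n
  finrank_eq : Module.finrank ℂ (codeSpace S) = 2 ^ k

/-- The stabilizer code of `S` has distance `d`: the least weight of a nontrivial logical Pauli
operator exists and equals `d`. -/
def HasDistance (S : Submonoid (Op ι)) (d : ℕ) : Prop :=
  IsLeast (logicalWeights S) d

/-- The stabilizer group of `CSS(C₁, C₂)`, generated by `X^x` for `x ∈ C₁^⊥` and `Z^z` for
`z ∈ C₂^⊥`. -/
def css (C₁ C₂ : Submodule (ZMod 2) (ι → ZMod 2)) : Submonoid (Op ι) :=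
  Submonoid.closure
    ({A | ∃ x ∈ dualCode C₁, A = xOp x} ∪ {A | ∃ z ∈ dualCode C₂, A = zOp z})

end Quantum

/-- The order-`(q, r)` quantum Coxeter code `CSS(C_W(m - q - 1), C_W(r))`, with qubits indexed by
the elements of `W`. -/
noncomputable def quantumCoxeter {B W : Type*} [Fintype B] [Group W] [Fintype W] [DecidableEq W]
    {M : CoxeterMatrix B} (cs : CoxeterSystem M W) (q r : ℤ) : Submonoid (Op W) :=
  css (coxeterCode cs ((Fintype.card B : ℤ) - q - 1)) (coxeterCode cs r)

end QCoxeter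

/-! Duality and dimension come from a squeeze. Indicators of cosets of `⟨J⟩` and `⟨K⟩` with `|J| +
|K| = m + 1` are orthogonal, because a common generator acts on the intersection without fixed
points. Hence `C(m - r - 1) ⊆ C(r)^⊥`. The cosets `w⟨J⟩`, with `J` the non-descents of `w`, have `w`
as unique shortest element, so they are unitriangular for length and give `dim C(r) ≥ #{d(w) ≤ r}`.
With descents in place of non-descents, `w` is the unique longest element, and `dim C(m - r - 1) ≥
#{d(w) > r}`. The two bounds add up to `|W|`, so both are equalities and the inclusion is an
equality. The code space of `CSS(C₁, C₂)` consists of the functions on `C₂ / C₁^⊥`, so `k = dim C(r)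
- dim C(q)`.

A nonzero word of `C(r)` has weight at least `2^(m - r)`: it is orthogonal to all cosets of rank `r
+ 1`, and its support can be split repeatedly between two cosets of some `⟨J \ {i}⟩`
(`two_pow_le_card_support`).

The bound is attained by `⟨I⟩` for `c` pairwise commuting generators, where `c` is the minimum of `q
+ 1` and `m - r`; such a set `I` exists when `2c ≤ m`, since the Coxeter graph of a finite group is
a forest (`exists_leaf`). This word avoids the next smaller code, whose nonzero words have weight at
least `2^(c + 1)`.

Two facts on Coxeter groups support this: the geometric representation, for the forest property and
for the distinctness of the generators, and the mod 2 inversion cocycle, for the exchange property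
and the extremal coset elements. -/

namespace QCoxeter

/-! ### The geometric representation -/

section Geometric

open Module Polynomial.Chebyshev

variable {B : Type*}

/-- The Gram coefficients `-cos (π / m_{ij})`; an infinite label, encoded as `0`, gives `-1`. -/
noncomputable def gram (M : CoxeterMatrix B) (i j : B) : ℝ := -Real.cos (Real.pi / M i j)

theorem gram_self (M : CoxeterMatrix B) (i : B) : gram M i i = 1 := by
  simp [gram]

theorem gram_symm (M : CoxeterMatrix B) (i j : B) : gram M i j = gram M j i := by
  simp [gram, M.symmetric i j]

theorem gram_eq_zero {M : CoxeterMatrix B} {i j : B} (h : M i j = 2) : gram M i j = 0 := by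
  simp [gram, h]

/-- The constant `1/2` is what lets two neighbours cancel the diagonal entry `1` in `exists_leaf`.
-/
theorem gram_le_neg_half {M : CoxeterMatrix B} {i j : B} (hij : i ≠ j) (h : M i j ≠ 2) :
    gram M i j ≤ -(1 / 2) := by
  have h1 : M i j ≠ 1 := M.off_diagonal i j hij
  unfold gram
  rw [neg_le_neg_iff, ← Real.cos_pi_div_three]
  rcases Nat.eq_zero_or_pos (M i j) with h0 | h0
  · simp [h0, Real.cos_pi_div_three]
    norm_num
  have h3 : (3 : ℝ) ≤ M i j := by
    have : 3 ≤ M i j := by omega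
    exact_mod_cast this
  apply Real.cos_le_cos_of_nonneg_of_le_pi
  · positivity
  · linarith [Real.pi_pos]
  · exact div_le_div_of_nonneg_left Real.pi_pos.le (by norm_num) h3

theorem gram_nonpos {M : CoxeterMatrix B} {i j : B} (hij : i ≠ j) : gram M i j ≤ 0 := by
  by_cases h : M i j = 2
  · exact (gram_eq_zero h).le
  · linarith [gram_le_neg_half hij h]

variable [Fintype B] [DecidableEq B]

/-- The coroot functionals of the geometric representation. -/
noncomputable def coroot (M : CoxeterMatrix B) (i : B) : Dual ℝ (B → ℝ) :=
  ∑ j, (2 * gram M i j) • LinearMap.proj j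

theorem coroot_single (M : CoxeterMatrix B) (i j : B) :
    coroot M i (Pi.single j 1) = 2 * gram M i j := by
  simp [coroot, Pi.single_apply]

theorem coroot_self (M : CoxeterMatrix B) (i : B) : coroot M i (Pi.single i 1) = 2 := by
  rw [coroot_single, gram_self, mul_one]

/-- The reflection in the `i`-th simple root. -/
noncomputable def geomReflection (M : CoxeterMatrix B) (i : B) : (B → ℝ) ≃ₗ[ℝ] (B → ℝ) :=
  reflection (coroot_self M i)

theorem geomReflection_apply (M : CoxeterMatrix B) (i : B) (v : B → ℝ) :
    geomReflection M i v = v - coroot M i v • Pi.single i 1 :=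
  reflection_apply _ _

/-- These products are the coefficients in the formula for the `m`-th power of a product of two
reflections. With `θ = 2π/m`, `S_n(2 cos θ) sin θ = sin((n + 1)θ)`. For `m = 2k` the factor
`S_{k-1}` vanishes since `kθ = π`; for `m = 2k + 1` the factor `S_k + S_{k-1}` vanishes since `(k +
1)θ = 2π - kθ`. -/
theorem chebyshev_vanish {m : ℕ} (hm : 3 ≤ m) (t : ℝ) (ht : t = 2 * Real.cos (2 * Real.pi / m)) :
    (S ℝ ((m - 2 : ℤ) / 2)).eval t *
        ((S ℝ ((m - 1 : ℤ) / 2)).eval t + (S ℝ ((m - 3 : ℤ) / 2)).eval t) = 0 ∧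
      (S ℝ ((m - 1 : ℤ) / 2)).eval t *
        ((S ℝ ((m : ℤ) / 2)).eval t + (S ℝ ((m - 2 : ℤ) / 2)).eval t) = 0 := by
  set θ := 2 * Real.pi / m with hθ
  have hm0 : (m : ℝ) ≠ 0 := by positivity
  have hm3 : (3 : ℝ) ≤ m := by exact_mod_cast hm
  have hmθ : m * θ = 2 * Real.pi := by rw [hθ]; field_simp
  have hsin : Real.sin θ ≠ 0 := by
    apply (Real.sin_pos_of_pos_of_lt_pi _ _).ne'
    · rw [hθ]; positivity
    · rw [hθ, div_lt_iff₀ (by positivity)]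
      nlinarith [Real.pi_pos]
  have key (n : ℤ) : (S ℝ n).eval t * Real.sin θ = Real.sin ((n + 1) * θ) := by
    rw [ht]; exact S_two_mul_real_cos θ n
  rcases Nat.even_or_odd' m with ⟨k, hk | hk⟩
  · have e1 : ((m : ℤ) - 2) / 2 = k - 1 := by omega
    have e2 : ((m : ℤ) - 1) / 2 = k - 1 := by omega
    have hz : (S ℝ ((k : ℤ) - 1)).eval t = 0 := by
      have := key (k - 1)
      have hk' : ((((k : ℤ) - 1 : ℤ) : ℝ) + 1) * θ = Real.pi := by
        push_cast
        have : (m : ℝ) = 2 * k := by exact_mod_cast hk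
        rw [this] at hmθ
        linarith
      rw [hk', Real.sin_pi] at this
      exact (mul_eq_zero.mp this).resolve_right hsin
    rw [e1, e2, hz]; simp
  · have e1 : ((m : ℤ) - 2) / 2 = k - 1 := by omega
    have e2 : ((m : ℤ) - 1) / 2 = k := by omega
    have e3 : ((m : ℤ) - 3) / 2 = k - 1 := by omega
    have e4 : (m : ℤ) / 2 = k := by omega
    have hz : (S ℝ (k : ℤ)).eval t + (S ℝ ((k : ℤ) - 1)).eval t = 0 := by
      have h1 := key k
      have h2 := key (k - 1)
      have hk' : (((k : ℤ) : ℝ) + 1) * θ = 2 * Real.pi - ((((k : ℤ) - 1 : ℤ) : ℝ) + 1) * θ := by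
        push_cast
        have : (m : ℝ) = 2 * k + 1 := by exact_mod_cast hk
        rw [this] at hmθ
        linarith
      rw [hk', Real.sin_two_pi_sub] at h1
      have : ((S ℝ (k : ℤ)).eval t + (S ℝ ((k : ℤ) - 1)).eval t) * Real.sin θ = 0 := by
        rw [add_mul, h1, h2]; ring
      exact (mul_eq_zero.mp this).resolve_right hsin
    rw [e1, e2, e3, e4, hz]; simp

theorem geomReflection_isLiftable (M : CoxeterMatrix B) : M.IsLiftable (geomReflection M) := by
  intro i j
  by_cases hij : i = j
  · subst hij
    rw [M.diagonal, pow_one]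
    ext1 v
    exact involutive_reflection (coroot_self M i) v
  have hM1 : M i j ≠ 1 := M.off_diagonal i j hij
  -- Label `2` is treated by hand: there `sin θ = 0` and the Chebyshev argument fails.
  rcases Nat.lt_or_ge (M i j) 3 with h3 | h3
  · rcases (show M i j = 0 ∨ M i j = 2 by omega) with h0 | h2
    · rw [h0, pow_zero]
    · have h2' : M j i = 2 := by rw [M.symmetric j i, h2]
      rw [h2, pow_two]
      refine LinearEquiv.ext fun v => ?_
      simp only [LinearEquiv.mul_apply, geomReflection_apply, map_sub, map_smul, coroot_self,
        coroot_single, gram_eq_zero h2, gram_eq_zero h2', LinearEquiv.coe_one, id]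
      module
  · refine LinearEquiv.ext fun v => ?_
    have ht : 2 * Real.cos (2 * Real.pi / M i j) =
        coroot M i (Pi.single j 1) * coroot M j (Pi.single i 1) - 2 := by
      rw [coroot_single, coroot_single, gram_symm M j i, gram,
        show 2 * Real.pi / (M i j : ℝ) = 2 * (Real.pi / M i j) by ring, Real.cos_two_mul]
      ring
    obtain ⟨ha, hb⟩ := chebyshev_vanish h3 _ rfl
    have := reflection_mul_reflection_pow_apply (coroot_self M i) (coroot_self M j) (M i j) v _ ht
    rw [ha, hb] at this
    simpa [geomReflection] using this

variable {W : Type*} [Group W] {M : CoxeterMatrix B}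

/-- The geometric representation of a Coxeter group. -/
noncomputable def geomRep (cs : CoxeterSystem M W) : W →* ((B → ℝ) ≃ₗ[ℝ] (B → ℝ)) :=
  cs.lift ⟨geomReflection M, geomReflection_isLiftable M⟩

theorem geomRep_simple (cs : CoxeterSystem M W) (i : B) (v : B → ℝ) :
    geomRep cs (cs.simple i) v = v - coroot M i v • Pi.single i 1 := by
  rw [geomRep, cs.lift_apply_simple, geomReflection_apply]

/-- `s_i` changes the `i`-th coordinate of the root `e_i` from `1` to `-1`, while `s_j` with `j ≠ i`
leaves every `i`-th coordinate alone. -/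
theorem simple_injective (cs : CoxeterSystem M W) : Function.Injective cs.simple := by
  intro i j h
  by_contra hij
  have h1 := geomRep_simple cs i (Pi.single i 1)
  rw [h, geomRep_simple, coroot_self] at h1
  have := congrFun h1 i
  simp [hij] at this
  norm_num at this

/-- A form on the geometric representation invariant under the finite Coxeter group. -/
noncomputable def invForm [Fintype W] (cs : CoxeterSystem M W) (v w : B → ℝ) : ℝ :=
  ∑ g : W, geomRep cs g v ⬝ᵥ geomRep cs g w

variable [Fintype W] (cs : CoxeterSystem M W)

theorem invForm_map (h : W) (v w : B → ℝ) :
    invForm cs (geomRep cs h v) (geomRep cs h w) = invForm cs v w := by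
  unfold invForm
  refine Fintype.sum_equiv (Equiv.mulRight h) _ _ fun g => ?_
  simp [map_mul]

theorem invForm_pos {v : B → ℝ} (hv : v ≠ 0) : 0 < invForm cs v v := by
  unfold invForm
  refine Finset.sum_pos (fun g _ => ?_) ⟨1, Finset.mem_univ _⟩
  have h : geomRep cs g v ≠ 0 := by simpa using hv
  have h0 : 0 ≤ geomRep cs g v ⬝ᵥ geomRep cs g v :=
    Finset.sum_nonneg fun i _ => mul_self_nonneg _
  exact lt_of_le_of_ne h0 fun h' => h (dotProduct_self_eq_zero.mp h'.symm)

theorem invForm_sum_left {κ : Type*} (T : Finset κ) (f : κ → B → ℝ) (w : B → ℝ) :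
    invForm cs (∑ i ∈ T, f i) w = ∑ i ∈ T, invForm cs (f i) w := by
  unfold invForm
  rw [Finset.sum_comm]
  simp [sum_dotProduct]

theorem invForm_sub_smul_right (u v w : B → ℝ) (c : ℝ) :
    invForm cs u (v - c • w) = invForm cs u v - c * invForm cs u w := by
  unfold invForm
  simp [Finset.mul_sum, Finset.sum_sub_distrib]

theorem invForm_neg_left (u v : B → ℝ) : invForm cs (-u) v = -invForm cs u v := by
  simp [invForm]

/-- Invariance under `s_i` forces this. The averaged positive definite form thus carries the signs
of the Gram coefficients, without a proof that the Gram form itself is positive definite. -/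
theorem invForm_single (i : B) (v : B → ℝ) :
    2 * invForm cs (Pi.single i 1) v =
      coroot M i v * invForm cs (Pi.single i 1) (Pi.single i 1) := by
  have h := invForm_map cs (cs.simple i) (Pi.single i 1) v
  rw [geomRep_simple, geomRep_simple, coroot_self,
    show (Pi.single i 1 - (2 : ℝ) • Pi.single i 1 : B → ℝ) = -Pi.single i 1 by module,
    invForm_neg_left, invForm_sub_smul_right] at h
  linarith

/-- The Coxeter graph of a finite Coxeter group is a forest: every nonempty vertex set has a vertex
with at most one neighbour in the set. -/
theorem exists_leaf (cs : CoxeterSystem M W) {T : Finset B} (hT : T.Nonempty) :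
    ∃ i ∈ T, (T.filter fun j => j ≠ i ∧ M i j ≠ 2).card ≤ 1 := by
  by_contra! hcon
  -- If every vertex of `T` had two neighbours in `T`, the sum `v` of the simple roots of `T` would
  -- pair nonpositively with each of them, so that its squared norm would be at most zero.
  set v : B → ℝ := ∑ i ∈ T, Pi.single i 1 with hv
  have hv0 : v ≠ 0 := by
    obtain ⟨i, hi⟩ := hT
    intro h
    have := congrFun h i
    simp [hv, Finset.sum_apply, Pi.single_apply, hi] at this
  have hpos := invForm_pos cs hv0
  have hneg : invForm cs v v ≤ 0 := by
    nth_rewrite 1 [hv]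
    rw [invForm_sum_left]
    refine Finset.sum_nonpos fun i hi => ?_
    have h1 := invForm_single cs i v
    have h2 : 0 < invForm cs (Pi.single i 1) (Pi.single i 1) :=
      invForm_pos cs (by simp)
    have h3 : coroot M i v ≤ 0 := by
      have hsum : coroot M i v = 2 * ∑ j ∈ T, gram M i j := by
        rw [hv, map_sum, Finset.mul_sum]
        exact Finset.sum_congr rfl fun j _ => coroot_single M i j
      have hle : ∀ j ∈ T.erase i,
          gram M i j ≤ if j ≠ i ∧ M i j ≠ 2 then -(1 / 2 : ℝ) else 0 := by
        intro j hj
        have hji : j ≠ i := Finset.ne_of_mem_erase hj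
        split_ifs with h
        · exact gram_le_neg_half hji.symm h.2
        · exact gram_nonpos hji.symm
      have hcard : (T.erase i).filter (fun j => j ≠ i ∧ M i j ≠ 2) =
          T.filter fun j => j ≠ i ∧ M i j ≠ 2 := by
        ext j
        simp only [Finset.mem_filter, Finset.mem_erase]
        tauto
      have hle' := Finset.sum_le_sum hle
      rw [← Finset.sum_filter, hcard, Finset.sum_const, nsmul_eq_mul] at hle'
      have h2c : (2 : ℝ) ≤ ((T.filter fun j => j ≠ i ∧ M i j ≠ 2).card : ℝ) := by
        exact_mod_cast hcon i hi
      rw [hsum, ← Finset.add_sum_erase T _ hi, gram_self]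
      linarith
    nlinarith
  linarith

/-- Greedy choice in a forest: keep a leaf and discard its at most one neighbour, so each kept
vertex costs at most two. -/
theorem exists_commuting_subset (cs : CoxeterSystem M W) (T : Finset B) :
    ∃ I ⊆ T, T.card ≤ 2 * I.card ∧ ∀ i ∈ I, ∀ j ∈ I, i ≠ j → M i j = 2 := by
  induction T using Finset.strongInduction with
  | H T ih =>
    rcases T.eq_empty_or_nonempty with rfl | hT
    · exact ⟨∅, by simp⟩
    obtain ⟨i, hi, hleaf⟩ := exists_leaf cs hT
    set N := T.filter fun j => j ≠ i ∧ M i j ≠ 2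
    have hiN : i ∉ N := by simp [N]
    have hNT : insert i N ⊆ T := by
      intro j hj
      rcases Finset.mem_insert.mp hj with rfl | hj
      · exact hi
      · exact (Finset.mem_filter.mp hj).1
    obtain ⟨I, hIT, hcard, hI⟩ := ih (T \ insert i N)
      (Finset.sdiff_ssubset hNT (Finset.insert_nonempty _ _))
    have hiI : i ∉ I := fun h => (Finset.mem_sdiff.mp (hIT h)).2 (Finset.mem_insert_self _ _)
    have hnew : ∀ j ∈ I, M i j = 2 := by
      intro j hj
      obtain ⟨hjT, hjn⟩ := Finset.mem_sdiff.mp (hIT hj)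
      by_contra h
      exact hjn (Finset.mem_insert_of_mem (Finset.mem_filter.mpr
        ⟨hjT, fun h' => hiI (h' ▸ hj), h⟩))
    refine ⟨insert i I, ?_, ?_, ?_⟩
    · exact Finset.insert_subset hi (hIT.trans Finset.sdiff_subset)
    · rw [Finset.card_insert_of_notMem hiI]
      have := Finset.card_sdiff_add_card_eq_card hNT
      rw [Finset.card_insert_of_notMem hiN] at this
      omega
    · intro a ha b hb hab
      rcases Finset.mem_insert.mp ha with rfl | ha' <;>
        rcases Finset.mem_insert.mp hb with rfl | hb'
      · exact absurd rfl hab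
      · exact hnew b hb'
      · rw [M.symmetric]; exact hnew a ha'
      · exact hI a ha' b hb' hab

end Geometric

/-! ### The inversion cocycle and the exchange property -/

section Cocycle

variable {B W : Type*} [Group W] {M : CoxeterMatrix B}

open scoped Classical in
/-- The action of a simple reflection on signed group elements `(t, ε)`: it conjugates `t`, and
flips the sign exactly when `t` is that simple reflection. -/
noncomputable def signedPerm (cs : CoxeterSystem M W) (i : B) : Equiv.Perm (W × ZMod 2) :=
  Function.Involutive.toPerm
    (fun p => (cs.simple i * p.1 * cs.simple i, p.2 + if p.1 = cs.simple i then 1 else 0)) <| by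
    rintro ⟨t, ε⟩
    have h : cs.simple i * t * cs.simple i = cs.simple i ↔ t = cs.simple i := by
      constructor
      · intro h
        have := congrArg (fun x => cs.simple i * x * cs.simple i) h
        simpa [mul_assoc] using this
      · rintro rfl; simp
    by_cases ht : t = cs.simple i
    · subst ht
      simp [add_assoc, CharTwo.add_self_eq_zero]
    · simp only [h, ht, if_false, add_zero]
      simp [mul_assoc]

open scoped Classical in
theorem signedPerm_apply (cs : CoxeterSystem M W) (i : B) (t : W) (ε : ZMod 2) :
    signedPerm cs i (t, ε) =
      (cs.simple i * t * cs.simple i, ε + if t = cs.simple i then 1 else 0) :=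
  rfl

open scoped Classical in
-- Each factor `s_i s_j` tests `t` against two more reflections of the dihedral group. For `n = M i
-- j` the list runs twice through the same terms, so the signs cancel and the braid relation holds.
theorem signedPerm_mul_pow_apply (cs : CoxeterSystem M W) (i j : B) (n : ℕ) (t : W) (ε : ZMod 2) :
    ((signedPerm cs i * signedPerm cs j) ^ n) (t, ε) =
      ((cs.simple i * cs.simple j) ^ n * t * ((cs.simple i * cs.simple j) ^ n)⁻¹,
        ε + ∑ k ∈ Finset.range (2 * n),
          if t = (cs.simple j * cs.simple i) ^ k * cs.simple j then 1 else 0) := by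
  induction n with
  | zero => simp
  | succ n ih =>
    set a := cs.simple i with ha
    set b := cs.simple j with hb
    have haa : a * a = 1 := cs.simple_mul_simple_self i
    have hbb : b * b = 1 := cs.simple_mul_simple_self j
    have hai : a⁻¹ = a := cs.inv_simple i
    have hbi : b⁻¹ = b := cs.inv_simple j
    have hinv : ((a * b) ^ n)⁻¹ = (b * a) ^ n := by
      rw [← inv_pow, mul_inv_rev, hai, hbi]
    have hcomm : b * (a * b) ^ n = (b * a) ^ n * b := by
      clear ih hinv
      induction n with
      | zero => simp
      | succ n ih => rw [pow_succ, ← mul_assoc, ih, pow_succ]; simp only [mul_assoc]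
    have e1 : (a * b) ^ n * t * ((a * b) ^ n)⁻¹ = b ↔ t = (b * a) ^ (2 * n) * b := by
      rw [mul_inv_eq_iff_eq_mul, ← eq_inv_mul_iff_mul_eq, hinv, hcomm, ← mul_assoc, two_mul,
        pow_add]
    have e2 : b * ((a * b) ^ n * t * ((a * b) ^ n)⁻¹) * b = a ↔
        t = (b * a) ^ (2 * n + 1) * b := by
      have : b * ((a * b) ^ n * t * ((a * b) ^ n)⁻¹) * b = a ↔
          (a * b) ^ n * t * ((a * b) ^ n)⁻¹ = b * a * b := by
        constructor
        · intro h
          have := congrArg (fun x => b * x * b) h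
          simp only [mul_assoc, hbb, mul_one] at this
          rw [← mul_assoc b b, hbb, one_mul] at this
          simpa only [mul_assoc] using this
        · intro h; rw [h]; simp only [mul_assoc, hbb, mul_one]
          rw [← mul_assoc b b, hbb, one_mul]
      rw [this, mul_inv_eq_iff_eq_mul, ← eq_inv_mul_iff_mul_eq, hinv, mul_assoc (b * a), hcomm,
        ← mul_assoc, ← mul_assoc, ← pow_succ, ← pow_add]
      rw [show n + 1 + n = 2 * n + 1 by ring]
    rw [pow_succ', Equiv.Perm.mul_apply, ih, Equiv.Perm.mul_apply, signedPerm_apply,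
      signedPerm_apply, ← ha, ← hb]
    refine Prod.ext ?_ ?_
    · simp only [pow_succ', mul_inv_rev, hai, hbi, mul_assoc]
    · simp only [e1, e2]
      rw [show 2 * (n + 1) = 2 * n + 1 + 1 by ring, Finset.sum_range_succ, Finset.sum_range_succ]
      ring

theorem signedPerm_isLiftable (cs : CoxeterSystem M W) : M.IsLiftable (signedPerm cs) := by
  classical
  intro i j
  refine Equiv.ext fun ⟨t, ε⟩ => ?_
  have h : (cs.simple j * cs.simple i) ^ M i j = 1 := cs.simple_mul_simple_pow' i j
  rw [signedPerm_mul_pow_apply, cs.simple_mul_simple_pow, two_mul, Finset.sum_range_add]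
  simp only [pow_add, h, one_mul, CharTwo.add_self_eq_zero]
  simp

/-- The action of a Coxeter group on its signed elements. -/
noncomputable def signedAction (cs : CoxeterSystem M W) : W →* Equiv.Perm (W × ZMod 2) :=
  cs.lift ⟨signedPerm cs, signedPerm_isLiftable cs⟩

/-- The inversion cocycle: on reflections `t`, it indicates whether `t` is a right inversion. -/
noncomputable def invCocycle (cs : CoxeterSystem M W) (w t : W) : ZMod 2 :=
  (signedAction cs w (t, 0)).2

variable (cs : CoxeterSystem M W)

open scoped Classical in
-- Since the left side depends only on the group element, so does the parity with which `t` occurs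
-- in the right inversion sequence of a word.
theorem signedAction_wordProd (ω : List B) (t : W) (ε : ZMod 2) :
    signedAction cs (cs.wordProd ω) (t, ε) =
      (cs.wordProd ω * t * (cs.wordProd ω)⁻¹, ε + ((cs.rightInvSeq ω).count t : ZMod 2)) := by
  induction ω with
  | nil => simp
  | cons i ω ih =>
    have e : cs.wordProd ω * t * (cs.wordProd ω)⁻¹ = cs.simple i ↔
        (cs.wordProd ω)⁻¹ * cs.simple i * cs.wordProd ω = t := by
      constructor
      · intro h; rw [← h]; group
      · intro h; rw [← h]; group
    rw [cs.wordProd_cons, map_mul, Equiv.Perm.mul_apply, ih, signedAction, cs.lift_apply_simple,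
      signedPerm_apply]
    refine Prod.ext ?_ ?_
    · simp [mul_assoc]
    · simp only [CoxeterSystem.rightInvSeq, List.count_cons, e, beq_iff_eq]
      push_cast
      rw [add_assoc]

open scoped Classical in
theorem invCocycle_wordProd (ω : List B) (t : W) :
    invCocycle cs (cs.wordProd ω) t = ((cs.rightInvSeq ω).count t : ZMod 2) := by
  rw [invCocycle, signedAction_wordProd, zero_add]

theorem signedAction_apply (w t : W) (ε : ZMod 2) :
    signedAction cs w (t, ε) = (w * t * w⁻¹, ε + invCocycle cs w t) := by
  classical
  obtain ⟨ω, rfl⟩ := cs.wordProd_surjective w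
  rw [signedAction_wordProd, invCocycle_wordProd]

theorem invCocycle_mul (u v t : W) :
    invCocycle cs (u * v) t = invCocycle cs v t + invCocycle cs u (v * t * v⁻¹) := by
  have : signedAction cs (u * v) (t, 0) = signedAction cs u (signedAction cs v (t, 0)) := by
    rw [map_mul, Equiv.Perm.mul_apply]
  rw [signedAction_apply, signedAction_apply, signedAction_apply] at this
  simpa using congrArg Prod.snd this

theorem invCocycle_one (t : W) : invCocycle cs 1 t = 0 := by
  simp [invCocycle]

theorem invCocycle_simple_self (i : B) : invCocycle cs (cs.simple i) (cs.simple i) = 1 := by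
  classical
  rw [← cs.wordProd_singleton i, invCocycle_wordProd]
  simp

theorem invCocycle_simple_of_ne {i : B} {t : W} (h : t ≠ cs.simple i) :
    invCocycle cs (cs.simple i) t = 0 := by
  classical
  rw [← cs.wordProd_singleton i, invCocycle_wordProd]
  simp [h.symm]

/-- For `t = w s w⁻¹`, the contributions of `w` and `w⁻¹` cancel and only that of `s` remains. -/
theorem invCocycle_reflection_self {t : W} (ht : cs.IsReflection t) : invCocycle cs t t = 1 := by
  obtain ⟨w, i, rfl⟩ := ht
  have h : invCocycle cs w (cs.simple i) +
      invCocycle cs w⁻¹ (w * cs.simple i * w⁻¹) = 0 := by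
    have := invCocycle_mul cs w⁻¹ w (cs.simple i)
    rw [inv_mul_cancel, invCocycle_one] at this
    exact this.symm
  rw [invCocycle_mul, invCocycle_mul]
  rw [show w⁻¹ * (w * cs.simple i * w⁻¹) * w⁻¹⁻¹ = cs.simple i by group,
    show cs.simple i * cs.simple i * (cs.simple i)⁻¹ = cs.simple i by group,
    invCocycle_simple_self]
  linear_combination h

theorem isRightInversion_of_invCocycle {w t : W} (h : invCocycle cs w t = 1) :
    cs.IsRightInversion w t := by
  classical
  obtain ⟨ω, hω, rfl⟩ := cs.exists_isReduced w
  rw [invCocycle_wordProd] at h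
  refine cs.isRightInversion_of_mem_rightInvSeq hω ?_
  by_contra hn
  rw [List.count_eq_zero_of_not_mem hn] at h
  simp at h

theorem zmod_two_eq_one_of_ne_zero {a : ZMod 2} (h : a ≠ 0) : a = 1 := by
  revert a; decide

theorem isRightInversion_iff {w t : W} (ht : cs.IsReflection t) :
    cs.IsRightInversion w t ↔ invCocycle cs w t = 1 := by
  refine ⟨fun h => ?_, isRightInversion_of_invCocycle cs⟩
  by_contra hn
  have h0 : invCocycle cs w t = 0 := by
    by_contra h0; exact hn (zmod_two_eq_one_of_ne_zero h0)
  -- If the cocycle vanishes at `w`, it equals `1` at `wt`, so `t` shortens `wt` and therefore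
  -- lengthens `w`.
  have h1 : invCocycle cs (w * t) t = 1 := by
    rw [invCocycle_mul, invCocycle_reflection_self cs ht, mul_assoc, mul_inv_cancel, mul_one, h0,
      add_zero]
  exact (ht.isRightInversion_mul_left_iff.mp (isRightInversion_of_invCocycle cs h1)) h

theorem isRightDescent_iff_invCocycle {w : W} {i : B} :
    cs.IsRightDescent w i ↔ invCocycle cs w (cs.simple i) = 1 := by
  rw [← cs.isRightInversion_simple_iff_isRightDescent,
    isRightInversion_iff cs (cs.isReflection_simple i)]

end Cocycle

/-! ### Standard subgroups -/

section Standard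

variable {B W : Type*} [Group W] {M : CoxeterMatrix B} (cs : CoxeterSystem M W)

theorem simple_mem_standardSubgroup {J : Finset B} {i : B} (hi : i ∈ J) :
    cs.simple i ∈ standardSubgroup cs J :=
  Subgroup.subset_closure ⟨i, hi, rfl⟩

theorem standardSubgroup_mono {J K : Finset B} (h : J ⊆ K) :
    standardSubgroup cs J ≤ standardSubgroup cs K :=
  Subgroup.closure_mono (Set.image_mono (by exact_mod_cast h))

theorem standardSubgroup_empty : standardSubgroup cs ∅ = ⊥ := by
  simp [standardSubgroup]

/-- Right induction on a standard subgroup. -/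
theorem standardSubgroup_induction {J : Finset B} {p : W → Prop} (one : p 1)
    (mul : ∀ w ∈ standardSubgroup cs J, ∀ i ∈ J, p w → p (w * cs.simple i)) {w : W}
    (hw : w ∈ standardSubgroup cs J) : p w := by
  refine Subgroup.closure_induction_right (p := fun x _ => p x) one ?_ ?_ hw
  · rintro x hx _ ⟨i, hi, rfl⟩ h
    exact mul x hx i hi h
  · rintro x hx _ ⟨i, hi, rfl⟩ h
    rw [cs.inv_simple]
    exact mul x hx i hi h

theorem exists_isReduced_of_mem_standardSubgroup {J : Finset B} {w : W}
    (hw : w ∈ standardSubgroup cs J) :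
    ∃ ω : List B, (∀ i ∈ ω, i ∈ J) ∧ cs.IsReduced ω ∧ cs.wordProd ω = w := by
  classical
  refine standardSubgroup_induction cs
    (p := fun w => ∃ ω : List B, (∀ i ∈ ω, i ∈ J) ∧ cs.IsReduced ω ∧ cs.wordProd ω = w)
    ⟨[], by simp, by simp [CoxeterSystem.IsReduced], by simp⟩ ?_ hw
  rintro _ - i hi ⟨ω, hJ, hω, rfl⟩
  by_cases hd : cs.IsRightDescent (cs.wordProd ω) i
  · have h1 := (isRightDescent_iff_invCocycle cs).mp hd
    -- Exchange: a descent `s_i` occurs in the right inversion sequence, and deleting the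
    -- corresponding letter gives a word for `w s_i`, still with letters in `J`.
    rw [invCocycle_wordProd] at h1
    have hmem : cs.simple i ∈ cs.rightInvSeq ω := by
      by_contra hn
      rw [List.count_eq_zero_of_not_mem hn] at h1
      simp at h1
    obtain ⟨j, hj, hji⟩ := List.mem_iff_getElem.mp hmem
    have hprod := cs.wordProd_mul_getD_rightInvSeq ω j
    rw [List.getD_eq_getElem _ 1 hj, hji] at hprod
    rw [cs.length_rightInvSeq] at hj
    refine ⟨ω.eraseIdx j, fun k hk => hJ k (List.mem_of_mem_eraseIdx hk), ?_, hprod.symm⟩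
    have h2 := cs.isRightDescent_iff.mp hd
    have h3 := List.length_eraseIdx_add_one hj
    rw [CoxeterSystem.IsReduced, ← hprod]
    rw [hω.eq] at h2
    omega
  · refine ⟨ω ++ [i], ?_, ?_, by simp [cs.wordProd_append]⟩
    · intro k hk
      rcases List.mem_append.mp hk with hk | hk
      · exact hJ k hk
      · rw [List.mem_singleton.mp hk]; exact hi
    · have h2 := cs.not_isRightDescent_iff.mp hd
      rw [CoxeterSystem.IsReduced, cs.wordProd_append, cs.wordProd_singleton, h2, hω.eq]
      simp

theorem simple_mem_standardSubgroup_iff [Finite B] {J : Finset B} {i : B} :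
    cs.simple i ∈ standardSubgroup cs J ↔ i ∈ J := by
  classical
  have := Fintype.ofFinite B
  refine ⟨fun h => ?_, simple_mem_standardSubgroup cs⟩
  obtain ⟨ω, hJ, hω, hprod⟩ := exists_isReduced_of_mem_standardSubgroup cs h
  have hlen := hω.eq
  rw [hprod, cs.length_simple] at hlen
  obtain ⟨j, rfl⟩ := List.length_eq_one_iff.mp hlen.symm
  rw [cs.wordProd_singleton] at hprod
  rw [← simple_injective cs hprod]
  exact hJ j (by simp)

/-- The letters of `u` contribute only conjugates of generators within `⟨J⟩`. -/
theorem invCocycle_eq_zero_of_notMem {J : Finset B} {u t : W} (hu : u ∈ standardSubgroup cs J)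
    (ht : t ∉ standardSubgroup cs J) : invCocycle cs u t = 0 := by
  refine standardSubgroup_induction cs
    (p := fun u => ∀ t, t ∉ standardSubgroup cs J → invCocycle cs u t = 0)
    (fun t _ => invCocycle_one cs t) ?_ hu t ht
  intro w hw i hi ih t ht
  have hs := simple_mem_standardSubgroup cs hi
  have hne : t ≠ cs.simple i := by rintro rfl; exact ht hs
  rw [invCocycle_mul, invCocycle_simple_of_ne cs hne, zero_add]
  refine ih _ fun h => ht ?_
  have := mul_mem (mul_mem (inv_mem hs) h) hs
  simpa [mul_assoc] using this

variable [Finite B]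

theorem mem_of_isRightDescent {J : Finset B} {u : W} (hu : u ∈ standardSubgroup cs J) {i : B}
    (hi : cs.IsRightDescent u i) : i ∈ J := by
  by_contra hiJ
  rw [isRightDescent_iff_invCocycle, invCocycle_eq_zero_of_notMem cs hu
    (fun h => hiJ ((simple_mem_standardSubgroup_iff cs).mp h))] at hi
  exact zero_ne_one hi

theorem eq_one_of_no_descent {J : Finset B} {u : W} (hu : u ∈ standardSubgroup cs J)
    (h : ∀ i ∈ J, ¬ cs.IsRightDescent u i) : u = 1 := by
  by_contra hne
  obtain ⟨i, hi⟩ := cs.exists_rightDescent_of_ne_one hne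
  exact h i (mem_of_isRightDescent cs hu hi) hi

/-- The subgroups `⟨J \ {i}⟩` meet trivially, since a descent of an element of `⟨J \ {i}⟩` differs
from `i`. This is what separates support points in the distance bound. -/
theorem eq_one_of_mem_erase [DecidableEq B] {J : Finset B} {u : W}
    (hu : u ∈ standardSubgroup cs J)
    (h : ∀ i ∈ J, u ∈ standardSubgroup cs (J.erase i)) : u = 1 :=
  eq_one_of_no_descent cs hu fun i hi hd =>
    Finset.notMem_erase i J (mem_of_isRightDescent cs (h i hi) hd)

/-- If `w` has no descents in `J`, it is the unique shortest element of `w⟨J⟩`. -/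
theorem length_lt_of_no_descent {J : Finset B} {w : W} (h : ∀ i ∈ J, ¬ cs.IsRightDescent w i)
    {u : W} (hu : u ∈ standardSubgroup cs J) (hu1 : u ≠ 1) :
    cs.length w < cs.length (w * u) := by
  obtain ⟨x, hx, hmin⟩ := exists_minimalFor_of_wellFoundedLT
    (fun x => x ∈ standardSubgroup cs J) (fun x => cs.length (w * x)) ⟨1, one_mem _⟩
  have hmin' : ∀ y ∈ standardSubgroup cs J, cs.length (w * x) ≤ cs.length (w * y) := by
    intro y hy
    by_contra! hlt
    exact absurd (hmin hy hlt.le) (not_le.mpr hlt)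
  -- every shortest element equals `w`
  have key : ∀ x ∈ standardSubgroup cs J,
      (∀ y ∈ standardSubgroup cs J, cs.length (w * x) ≤ cs.length (w * y)) → x = 1 := by
    intro x hx hmin
    have hx1 : x⁻¹ = 1 := by
      -- Let `i` be a descent of `x⁻¹`. No reflection of `⟨J⟩` shortens the minimal `wx`, so in the
      -- cocycle identity for `w = (wx)x⁻¹` only `x⁻¹` contributes, and `i` is a descent of `w`.
      refine eq_one_of_no_descent cs (inv_mem hx) fun i hi hd => h i hi ?_
      rw [isRightDescent_iff_invCocycle] at hd ⊢
      have hw : w = (w * x) * x⁻¹ := by group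
      rw [hw, invCocycle_mul, hd, add_eq_left]
      by_contra hne
      have hinv := isRightInversion_of_invCocycle cs (zmod_two_eq_one_of_ne_zero hne)
      have hmem := mul_mem (mul_mem (inv_mem hx) (simple_mem_standardSubgroup cs hi))
        (inv_mem (inv_mem hx))
      have := hmin _ (mul_mem hx hmem)
      rw [← mul_assoc] at this
      exact absurd hinv.2 (not_lt.mpr this)
    simpa using hx1
  have hx1 := key x hx hmin'
  subst hx1
  rw [mul_one] at hmin'
  refine lt_of_le_of_ne (hmin' u hu) fun heq => hu1 (key u hu ?_)
  rwa [← heq]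

/-- If every element of `J` is a descent of `w`, then `w` is the unique longest element of
`w⟨J⟩`. -/
theorem length_lt_of_all_descents [Finite W] {J : Finset B} {w : W}
    (h : ∀ i ∈ J, cs.IsRightDescent w i)
    {u : W} (hu : u ∈ standardSubgroup cs J) (hu1 : u ≠ 1) :
    cs.length (w * u) < cs.length w := by
  obtain ⟨x, hx, hmax⟩ := Set.exists_max_image (standardSubgroup cs J : Set W)
    (fun x => cs.length (w * x)) (Set.toFinite _) ⟨1, one_mem _⟩
  have key : ∀ x ∈ standardSubgroup cs J,
      (∀ y ∈ standardSubgroup cs J, cs.length (w * y) ≤ cs.length (w * x)) → x = 1 := by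
    intro x hx hmax
    have hx1 : x⁻¹ = 1 := by
      -- Dually, every reflection of `⟨J⟩` shortens the maximal `wx`, so both terms of the cocycle
      -- identity are `1` and cancel, although `i` is a descent of `w`.
      refine eq_one_of_no_descent cs (inv_mem hx) fun i hi hd => ?_
      have hdw := h i hi
      rw [isRightDescent_iff_invCocycle] at hd hdw
      have hw : w = (w * x) * x⁻¹ := by group
      have hrefl := (cs.isReflection_simple i).conj x⁻¹
      have hmem := mul_mem (mul_mem (inv_mem hx) (simple_mem_standardSubgroup cs hi))
        (inv_mem (inv_mem hx))
      have hle := hmax _ (mul_mem hx hmem)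
      rw [← mul_assoc] at hle
      have hinv : cs.IsRightInversion (w * x) (x⁻¹ * cs.simple i * x⁻¹⁻¹) :=
        ⟨hrefl, lt_of_le_of_ne hle (hrefl.length_mul_left_ne _)⟩
      rw [isRightInversion_iff cs hrefl] at hinv
      rw [hw, invCocycle_mul, hd, hinv] at hdw
      exact absurd hdw (by decide)
    simpa using hx1
  have hx1 := key x hx hmax
  subst hx1
  simp only [mul_one] at hmax
  refine lt_of_le_of_ne (hmax u hu) fun heq => hu1 (key u hu ?_)
  rwa [heq]

end Standard

/-! ### Binary codes and their duals -/

section Dual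

variable {ι : Type*} [Fintype ι]

theorem mem_dualCode {C : Submodule (ZMod 2) (ι → ZMod 2)} {y : ι → ZMod 2} :
    y ∈ dualCode C ↔ ∀ x ∈ C, x ⬝ᵥ y = 0 :=
  Iff.rfl

theorem dualCode_eq_orthogonal [DecidableEq ι] (C : Submodule (ZMod 2) (ι → ZMod 2)) :
    dualCode C = (Matrix.toBilin' (1 : Matrix ι ι (ZMod 2))).orthogonal C := by
  ext y
  simp [mem_dualCode, LinearMap.BilinForm.mem_orthogonal_iff, Matrix.toBilin'_apply']

theorem dotForm_nondegenerate [DecidableEq ι] :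
    (Matrix.toBilin' (1 : Matrix ι ι (ZMod 2))).Nondegenerate :=
  LinearMap.BilinForm.nondegenerate_toBilin'_of_det_ne_zero' _ (by simp)

theorem dotForm_isRefl [DecidableEq ι] :
    (Matrix.toBilin' (1 : Matrix ι ι (ZMod 2))).IsRefl := by
  intro x y h
  simp only [Matrix.toBilin'_apply', Matrix.one_mulVec] at h ⊢
  rwa [dotProduct_comm]

theorem finrank_dualCode (C : Submodule (ZMod 2) (ι → ZMod 2)) :
    Module.finrank (ZMod 2) (dualCode C) = Fintype.card ι - Module.finrank (ZMod 2) C := by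
  classical
  rw [dualCode_eq_orthogonal, LinearMap.BilinForm.finrank_orthogonal dotForm_nondegenerate,
    Module.finrank_fintype_fun_eq_card]

theorem finrank_le_card (C : Submodule (ZMod 2) (ι → ZMod 2)) :
    Module.finrank (ZMod 2) C ≤ Fintype.card ι := by
  have := Submodule.finrank_le C
  rwa [Module.finrank_fintype_fun_eq_card] at this

theorem dualCode_dualCode (C : Submodule (ZMod 2) (ι → ZMod 2)) : dualCode (dualCode C) = C := by
  classical
  rw [dualCode_eq_orthogonal, dualCode_eq_orthogonal,
    LinearMap.BilinForm.orthogonal_orthogonal dotForm_nondegenerate dotForm_isRefl]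

/-- A family of functions that is unitriangular for a height function is independent. -/
theorem linearIndependent_of_triangular {K : Type*} [Field K] (P : ι → Prop) (f : ι → ι → K)
    (height : ι → ℤ) (hdiag : ∀ w, P w → f w w ≠ 0)
    (htri : ∀ w v, P w → f w v ≠ 0 → v ≠ w → height w < height v) :
    LinearIndependent K fun w : {w // P w} => f w := by
  classical
  rw [Fintype.linearIndependent_iff]
  intro g hg
  by_contra! hne
  obtain ⟨i, hi⟩ := hne
  -- At a point of least height among the nonzero coefficients, no other function in the relation is
  -- nonzero.
  obtain ⟨w, hw, hmin⟩ := Finset.exists_min_image (Finset.univ.filter fun w => g w ≠ 0)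
    (fun w => height w) ⟨i, by simpa using hi⟩
  have hw0 : g w ≠ 0 := by simpa using hw
  have h := congrFun hg w
  rw [Finset.sum_apply, Finset.sum_eq_single w] at h
  · exact (mul_ne_zero hw0 (hdiag w w.2)) h
  · intro v _ hv
    by_contra hne
    have hgv : g v ≠ 0 := fun h' => hne (by simp [h'])
    have hfv : f v w ≠ 0 := fun h' => hne (by simp [h'])
    have h1 := htri v w v.2 hfv (fun h' => hv (Subtype.ext h'.symm))
    have h2 := hmin v (by simpa using hgv)
    omega
  · simp

theorem card_le_finrank_of_triangular (C : Submodule (ZMod 2) (ι → ZMod 2)) (P : ι → Prop)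
    (f : ι → ι → ZMod 2) (hmem : ∀ w, P w → f w ∈ C)
    (height : ι → ℤ) (hdiag : ∀ w, P w → f w w ≠ 0)
    (htri : ∀ w v, P w → f w v ≠ 0 → v ≠ w → height w < height v) :
    {w | P w}.ncard ≤ Module.finrank (ZMod 2) C := by
  classical
  have h := linearIndependent_of_triangular P f height hdiag htri
  have h' : LinearIndependent (ZMod 2) fun w : {w // P w} => (⟨f w, hmem w w.2⟩ : C) :=
    LinearIndependent.of_comp C.subtype h
  have := h'.fintype_card_le_finrank
  rwa [← Nat.card_eq_fintype_card] at this

end Dual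

/-! ### Classical Coxeter codes -/

section Codes

variable {B W : Type*} [Group W] {M : CoxeterMatrix B}

/-- The indicator of the coset `σ⟨J⟩`. -/
noncomputable def cosetWord (cs : CoxeterSystem M W) (σ : W) (J : Finset B) : W → ZMod 2 :=
  Set.indicator (σ • (standardSubgroup cs J : Set W)) 1

open scoped Classical in
theorem cosetWord_apply (cs : CoxeterSystem M W) (σ : W) (J : Finset B) (w : W) :
    cosetWord cs σ J w = if σ⁻¹ * w ∈ standardSubgroup cs J then 1 else 0 := by
  simp [cosetWord, Set.indicator_apply, Set.mem_smul_set_iff_inv_smul_mem]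

theorem invariant_mem_span [Fintype W] (H : Subgroup W) {f : W → ZMod 2}
    (hf : ∀ w, ∀ h ∈ H, f (w * h) = f w) :
    f ∈ Submodule.span (ZMod 2) {g | ∃ τ : W, g = Set.indicator (τ • (H : Set W)) 1} := by
  classical
  have h : f = ∑ q : W ⧸ H, f q.out • Set.indicator (q.out • (H : Set W)) (1 : W → ZMod 2) := by
    funext w
    have hmem (q : W ⧸ H) : w ∈ q.out • (H : Set W) ↔ q = (w : W ⧸ H) := by
      rw [Set.mem_smul_set_iff_inv_smul_mem, smul_eq_mul, SetLike.mem_coe, ← QuotientGroup.eq,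
        QuotientGroup.out_eq']
    rw [Finset.sum_apply, Finset.sum_eq_single (w : W ⧸ H)]
    · have := QuotientGroup.mk_out_eq_mul H w
      obtain ⟨h, hh⟩ := this
      rw [Pi.smul_apply, Set.indicator_of_mem ((hmem _).mpr rfl), hh, hf w h h.2]
      simp
    · intro q _ hq
      simp [hmem, hq]
    · simp
  rw [h]
  exact Submodule.sum_mem _ fun q _ => Submodule.smul_mem _ _ (Submodule.subset_span ⟨q.out, rfl⟩)

variable (cs : CoxeterSystem M W)

theorem simple_ne_one (i : B) : cs.simple i ≠ 1 := by
  intro h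
  have := cs.length_simple i
  rw [h, cs.length_one] at this
  omega

/-- Right multiplication by a common generator is a fixed-point-free involution preserving both
cosets. -/
theorem cosetWord_dotProduct [Fintype W] [DecidableEq B] {σ τ : W} {J K : Finset B}
    (h : (J ∩ K).Nonempty) : cosetWord cs σ J ⬝ᵥ cosetWord cs τ K = 0 := by
  classical
  obtain ⟨i, hi⟩ := h
  obtain ⟨hJ, hK⟩ := Finset.mem_inter.mp hi
  have hinv : ∀ (ρ : W) (L : Finset B), i ∈ L → ∀ w,
      cosetWord cs ρ L (w * cs.simple i) = cosetWord cs ρ L w := by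
    intro ρ L hL w
    rw [cosetWord_apply, cosetWord_apply, ← mul_assoc,
      Subgroup.mul_mem_cancel_right _ (simple_mem_standardSubgroup cs hL)]
  refine Finset.sum_involution (fun w _ => w * cs.simple i) ?_ ?_ ?_ ?_
  · intro w _
    rw [hinv σ J hJ, hinv τ K hK, CharTwo.add_self_eq_zero]
  · intro w _ _ h
    exact simple_ne_one cs i (mul_eq_left.mp h)
  · simp
  · simp

theorem ncard_add_ncard_lt [Fintype W] (r : ℤ) :
    {w | (descentNumber cs w : ℤ) ≤ r}.ncard + {w | r < (descentNumber cs w : ℤ)}.ncard =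
      Fintype.card W := by
  have h : {w | r < (descentNumber cs w : ℤ)} = {w | (descentNumber cs w : ℤ) ≤ r}ᶜ := by
    ext w; simp
  rw [h, Set.ncard_add_ncard_compl, Nat.card_eq_fintype_card]

variable [Fintype B]

theorem cosetWord_mem_of_card_eq {r : ℤ} {σ : W} {J : Finset B}
    (hJ : (J.card : ℤ) = (Fintype.card B : ℤ) - r) : cosetWord cs σ J ∈ coxeterCode cs r :=
  Submodule.subset_span ⟨σ, J, hJ, rfl⟩

/-- A coset of `⟨J⟩` is a disjoint union of cosets of `⟨K⟩` for any `K ⊆ J`. -/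
theorem cosetWord_mem [Fintype W] {r : ℤ} (hr : r ≤ Fintype.card B) {σ : W} {J : Finset B}
    (hJ : (Fintype.card B : ℤ) - r ≤ J.card) : cosetWord cs σ J ∈ coxeterCode cs r := by
  classical
  obtain ⟨K, hKJ, hK⟩ := Finset.exists_subset_card_eq
    (show ((Fintype.card B : ℤ) - r).toNat ≤ J.card by omega)
  have hinv : ∀ w, ∀ h ∈ standardSubgroup cs K,
      cosetWord cs σ J (w * h) = cosetWord cs σ J w := by
    intro w h hh
    rw [cosetWord_apply, cosetWord_apply, ← mul_assoc,
      Subgroup.mul_mem_cancel_right _ (standardSubgroup_mono cs hKJ hh)]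
  refine Submodule.span_mono ?_ (invariant_mem_span _ hinv)
  rintro _ ⟨τ, rfl⟩
  exact ⟨τ, K, by omega, rfl⟩

theorem coxeterCode_le_dualCode [Fintype W] (r : ℤ) :
    coxeterCode cs ((Fintype.card B : ℤ) - r - 1) ≤ dualCode (coxeterCode cs r) := by
  classical
  refine Submodule.span_le.mpr ?_
  rintro _ ⟨τ, K, hK, rfl⟩ x hx
  induction hx using Submodule.span_induction with
  | mem x hx =>
    obtain ⟨σ, J, hJ, rfl⟩ := hx
    refine cosetWord_dotProduct cs ?_
    rw [← Finset.card_pos]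
    have h1 := Finset.card_union_add_card_inter J K
    have h2 := Finset.card_le_univ (J ∪ K)
    omega
  | zero => exact zero_dotProduct _
  | add x y _ _ hx hy => rw [add_dotProduct, hx, hy, add_zero]
  | smul c x _ hx => rw [smul_dotProduct, hx, smul_zero]

open scoped Classical in
theorem descentNumber_eq (w : W) :
    descentNumber cs w = (Finset.univ.filter fun i => cs.IsRightDescent w i).card := by
  rw [descentNumber, ← Set.ncard_coe_finset]
  simp

variable [Fintype W]

theorem ncard_le_finrank {r : ℤ} (hr : r ≤ Fintype.card B) :
    {w | (descentNumber cs w : ℤ) ≤ r}.ncard ≤ Module.finrank (ZMod 2) (coxeterCode cs r) := by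
  classical
  refine card_le_finrank_of_triangular _ _
    (fun w => cosetWord cs w (Finset.univ.filter fun i => ¬ cs.IsRightDescent w i)) ?_
    (fun w => cs.length w) ?_ ?_
  · intro w hw
    refine cosetWord_mem cs hr ?_
    have := Finset.card_filter_add_card_filter_not (s := Finset.univ) (cs.IsRightDescent w)
    rw [← descentNumber_eq, Finset.card_univ] at this
    omega
  · intro w _
    simp [cosetWord_apply]
  · intro w v _ hv hne
    have hu : w⁻¹ * v ∈ standardSubgroup cs (Finset.univ.filter fun i => ¬ cs.IsRightDescent w i) :=
      by by_contra hn; exact hv (by simp only [cosetWord_apply, if_neg hn])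
    have := length_lt_of_no_descent cs (w := w) (fun i hi => (Finset.mem_filter.mp hi).2) hu
      (fun h => hne (inv_mul_eq_one.mp h).symm)
    rw [mul_inv_cancel_left] at this
    exact_mod_cast this

theorem ncard_le_finrank_of_lt {r : ℤ} (hr : -1 ≤ r) :
    {w | r < (descentNumber cs w : ℤ)}.ncard ≤
      Module.finrank (ZMod 2) (coxeterCode cs ((Fintype.card B : ℤ) - r - 1)) := by
  classical
  refine card_le_finrank_of_triangular _ _
    (fun w => cosetWord cs w (Finset.univ.filter fun i => cs.IsRightDescent w i)) ?_
    (fun w => -cs.length w) ?_ ?_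
  · intro w hw
    refine cosetWord_mem cs (by omega) ?_
    rw [← descentNumber_eq]
    omega
  · intro w _
    simp [cosetWord_apply]
  · intro w v _ hv hne
    have hu : w⁻¹ * v ∈ standardSubgroup cs (Finset.univ.filter fun i => cs.IsRightDescent w i) :=
      by by_contra hn; exact hv (by simp only [cosetWord_apply, if_neg hn])
    have := length_lt_of_all_descents cs (w := w) (fun i hi => (Finset.mem_filter.mp hi).2) hu
      (fun h => hne (inv_mul_eq_one.mp h).symm)
    rw [mul_inv_cancel_left] at this
    omega

/-- The lower bounds for the two dimensions already sum to `|W|`, so the inclusion in the dual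
leaves no room. -/
theorem dualCode_coxeterCode {r : ℤ} (h1 : -1 ≤ r) (h2 : r ≤ Fintype.card B) :
    dualCode (coxeterCode cs r) = coxeterCode cs ((Fintype.card B : ℤ) - r - 1) := by
  refine (Submodule.eq_of_le_of_finrank_le (coxeterCode_le_dualCode cs r) ?_).symm
  have ha := ncard_le_finrank cs h2
  have hb := ncard_le_finrank_of_lt cs h1
  have hc := ncard_add_ncard_lt cs r
  rw [finrank_dualCode]
  omega

theorem finrank_coxeterCode {r : ℤ} (h1 : -1 ≤ r) (h2 : r ≤ Fintype.card B) :
    Module.finrank (ZMod 2) (coxeterCode cs r) = {w | (descentNumber cs w : ℤ) ≤ r}.ncard := by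
  have ha := ncard_le_finrank cs h2
  have hb := ncard_le_finrank_of_lt cs h1
  have hc := ncard_add_ncard_lt cs r
  rw [← dualCode_coxeterCode cs h1 h2, finrank_dualCode] at hb
  have hd := finrank_le_card (coxeterCode cs r)
  omega

theorem coxeterCode_mono {q r : ℤ} (hqr : q ≤ r) (hr : r ≤ Fintype.card B) :
    coxeterCode cs q ≤ coxeterCode cs r := by
  refine Submodule.span_le.mpr ?_
  rintro _ ⟨σ, J, hJ, rfl⟩
  exact cosetWord_mem cs hr (by omega)

theorem finrank_sub_eq_sum {q r : ℤ} (hq : -1 ≤ q) (hqr : q ≤ r) (hr : r ≤ Fintype.card B) :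
    Module.finrank (ZMod 2) (coxeterCode cs r) - Module.finrank (ZMod 2) (coxeterCode cs q) =
      ∑ i ∈ Finset.Icc (q + 1) r, eulerian cs i.toNat := by
  classical
  rw [finrank_coxeterCode cs (hq.trans hqr) hr, finrank_coxeterCode cs hq (hqr.trans hr),
    ← Set.ncard_sdiff (s := {w | (descentNumber cs w : ℤ) ≤ q})
      (t := {w | (descentNumber cs w : ℤ) ≤ r}) (fun w hw => le_trans hw hqr)]
  have hset : ({w | (descentNumber cs w : ℤ) ≤ r} \ {w | (descentNumber cs w : ℤ) ≤ q} : Set W) =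
      ((Finset.univ.filter fun w => (descentNumber cs w : ℤ) ∈ Finset.Icc (q + 1) r :
        Finset W) : Set W) := by
    ext w
    simp only [Set.mem_sdiff, Set.mem_ofPred_eq, Finset.coe_filter, Finset.mem_univ, true_and,
      Finset.mem_Icc]
    omega
  rw [hset, Set.ncard_coe_finset,
    Finset.card_eq_sum_card_fiberwise (f := fun w => (descentNumber cs w : ℤ))
      (t := Finset.Icc (q + 1) r) (by intro w hw; simpa using hw)]
  refine Finset.sum_congr rfl fun i hi => ?_
  rw [eulerian, ← Set.ncard_coe_finset]
  congr 1
  ext w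
  have := Finset.mem_Icc.mp hi
  simp only [Finset.coe_filter, Finset.mem_filter, Finset.mem_univ, true_and, Finset.mem_Icc,
    Set.mem_ofPred_eq]
  omega

end Codes

/-! ### Minimum distance of Coxeter codes -/

section Distance

variable {B W : Type*} [Group W] {M : CoxeterMatrix B} (cs : CoxeterSystem M W)

theorem simple_commute {i j : B} (h : M i j = 2) : Commute (cs.simple i) (cs.simple j) := by
  have h1 := cs.simple_mul_simple_pow i j
  rw [h, pow_two] at h1
  have h2 := eq_inv_of_mul_eq_one_left h1
  rwa [mul_inv_rev, cs.inv_simple, cs.inv_simple] at h2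

variable [Fintype W]

open scoped Classical in
/-- A function on a coset `σ⟨J⟩` that is orthogonal to all the cosets of rank `k` in it either
vanishes there or has weight at least `2 ^ (|J| + 1 - k)`. -/
theorem two_pow_le_card_support [Finite B] (k : ℕ) (f : W → ZMod 2) (J : Finset B)
    (horth : ∀ K ⊆ J, K.card = k → ∀ τ, cosetWord cs τ K ⬝ᵥ f = 0) (σ : W) (hσ : f σ ≠ 0) :
    2 ^ (J.card + 1 - k) ≤
      (Finset.univ.filter fun w => σ⁻¹ * w ∈ standardSubgroup cs J ∧ f w ≠ 0).card := by
  induction hn : J.card generalizing J σ with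
  | zero =>
    -- For `k = 0` orthogonality to the singleton `{σ}` contradicts `f σ ≠ 0`; for `k > 0` the
    -- truncated exponent is `0`.
    rcases Nat.eq_zero_or_pos k with rfl | hk
    · have h := horth J subset_rfl hn σ
      rw [Finset.card_eq_zero.mp hn] at h
      rw [dotProduct, Finset.sum_eq_single σ] at h
      · simp [cosetWord_apply, standardSubgroup_empty] at h
        exact absurd h hσ
      · intro w _ hw
        rw [cosetWord_apply, standardSubgroup_empty, if_neg, zero_mul]
        rw [Subgroup.mem_bot, inv_mul_eq_one]
        exact hw.symm
      · simp
    · rw [show 0 + 1 - k = 0 by omega, pow_zero]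
      exact Finset.card_pos.mpr ⟨σ, by simp [hσ]⟩
  | succ n ih =>
    rcases Nat.lt_or_ge (n + 1) k with hk | hk
    · rw [show n + 1 + 1 - k = 0 by omega, pow_zero]
      exact Finset.card_pos.mpr ⟨σ, by simp [hσ]⟩
    -- Either the support meets two different cosets of some `⟨J \ {i}⟩`, each contributing half of
    -- the bound, or `σ` is its only point in `σ⟨J⟩` and pairing with `σ⟨K⟩` gives `f σ = 0`.
    by_cases hsep : ∃ i ∈ J, ∃ b, σ⁻¹ * b ∈ standardSubgroup cs J ∧ f b ≠ 0 ∧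
        σ⁻¹ * b ∉ standardSubgroup cs (J.erase i)
    · obtain ⟨i, hi, b, hb, hfb, hsep⟩ := hsep
      have hcard : (J.erase i).card = n := by rw [Finset.card_erase_of_mem hi]; omega
      have horth' : ∀ K ⊆ J.erase i, K.card = k → ∀ τ, cosetWord cs τ K ⬝ᵥ f = 0 :=
        fun K hK => horth K (hK.trans (Finset.erase_subset _ _))
      have h1 := ih (J.erase i) horth' σ hσ hcard
      have h2 := ih (J.erase i) horth' b hfb hcard
      have hdisj : Disjoint
          (Finset.univ.filter fun w => σ⁻¹ * w ∈ standardSubgroup cs (J.erase i) ∧ f w ≠ 0)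
          (Finset.univ.filter fun w => b⁻¹ * w ∈ standardSubgroup cs (J.erase i) ∧ f w ≠ 0) := by
        rw [Finset.disjoint_left]
        intro w hw hw'
        refine hsep ?_
        have := mul_mem (Finset.mem_filter.mp hw).2.1 (inv_mem (Finset.mem_filter.mp hw').2.1)
        simpa [mul_assoc] using this
      have hsub := standardSubgroup_mono cs (Finset.erase_subset i J)
      calc 2 ^ (n + 1 + 1 - k) = 2 ^ (n + 1 - k) + 2 ^ (n + 1 - k) := by
            rw [show n + 1 + 1 - k = (n + 1 - k) + 1 by omega, pow_succ]; ring
        _ ≤ _ := Nat.add_le_add h1 h2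
        _ = _ := (Finset.card_union_of_disjoint hdisj).symm
        _ ≤ _ := by
            refine Finset.card_le_card fun w hw => ?_
            rcases Finset.mem_union.mp hw with hw | hw <;>
              obtain ⟨-, hw, hfw⟩ := Finset.mem_filter.mp hw <;>
              refine Finset.mem_filter.mpr ⟨Finset.mem_univ _, ?_, hfw⟩
            · exact hsub hw
            · have := mul_mem hb (hsub hw)
              simpa [mul_assoc] using this
    · push Not at hsep
      exfalso
      have huniq : ∀ b, σ⁻¹ * b ∈ standardSubgroup cs J → f b ≠ 0 → b = σ := by
        intro b hb hfb
        have := eq_one_of_mem_erase cs hb fun i hi => hsep i hi b hb hfb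
        exact (inv_mul_eq_one.mp this).symm
      obtain ⟨K, hKJ, hK⟩ := Finset.exists_subset_card_eq (show k ≤ J.card by omega)
      have h := horth K hKJ hK σ
      rw [dotProduct, Finset.sum_eq_single σ] at h
      · rw [cosetWord_apply, inv_mul_cancel, if_pos (one_mem _), one_mul] at h
        exact hσ h
      · intro b _ hb
        rw [cosetWord_apply]
        split_ifs with hmem
        · rw [one_mul]
          by_contra hfb
          exact hb (huniq b (standardSubgroup_mono cs hKJ hmem) hfb)
        · exact zero_mul _
      · simp

theorem two_pow_le_hammingNorm [Fintype B] {r : ℤ} (h1 : -1 ≤ r) {f : W → ZMod 2}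
    (hf : f ∈ coxeterCode cs r) (hf0 : f ≠ 0) :
    2 ^ ((Fintype.card B : ℤ) - r).toNat ≤ hammingNorm f := by
  classical
  obtain ⟨σ, hσ⟩ := Function.ne_iff.mp hf0
  have h := two_pow_le_card_support cs (r + 1).toNat f Finset.univ (by
    intro K _ hK τ
    rw [dotProduct_comm]
    exact coxeterCode_le_dualCode cs r (cosetWord_mem_of_card_eq cs (by omega)) f hf) σ hσ
  rw [Finset.card_univ, show Fintype.card B + 1 - (r + 1).toNat =
    ((Fintype.card B : ℤ) - r).toNat by omega] at h
  refine h.trans (Finset.card_le_card fun w hw => ?_)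
  exact Finset.mem_filter.mpr ⟨Finset.mem_univ _, (Finset.mem_filter.mp hw).2.2⟩

/-- An upper bound suffices: the matching lower bound comes from the minimum distance. -/
theorem ncard_standardSubgroup_le (I : Finset B)
    (hI : ∀ i ∈ I, ∀ j ∈ I, i ≠ j → M i j = 2) :
    (standardSubgroup cs I : Set W).ncard ≤ 2 ^ I.card := by
  classical
  induction I using Finset.induction_on with
  | empty => simp [standardSubgroup_empty]
  | insert i I hi ih =>
    have ih' := ih fun a ha b hb => hI a (Finset.mem_insert_of_mem ha) b
      (Finset.mem_insert_of_mem hb)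
    have hsub : (standardSubgroup cs (insert i I) : Set W) ⊆
        (standardSubgroup cs I : Set W) ∪
          (fun w => w * cs.simple i) '' (standardSubgroup cs I : Set W) := by
      intro w hw
      refine standardSubgroup_induction cs (p := fun w => w ∈ (standardSubgroup cs I : Set W) ∪
        (fun w => w * cs.simple i) '' (standardSubgroup cs I : Set W))
        (Or.inl (one_mem _)) ?_ hw
      rintro v - j hj (hv | ⟨h, hh, rfl⟩)
      · rcases Finset.mem_insert.mp hj with rfl | hj
        · exact Or.inr ⟨v, hv, rfl⟩
        · exact Or.inl (mul_mem hv (simple_mem_standardSubgroup cs hj))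
      · rcases Finset.mem_insert.mp hj with rfl | hj
        · left; simpa using hh
        · right
          refine ⟨h * cs.simple j, mul_mem hh (simple_mem_standardSubgroup cs hj), ?_⟩
          have hc := simple_commute cs (hI i (Finset.mem_insert_self _ _) j
            (Finset.mem_insert_of_mem hj) (fun h => hi (h ▸ hj)))
          simp only [mul_assoc, hc.eq]
    calc _ ≤ _ := Set.ncard_le_ncard hsub (Set.toFinite _)
      _ ≤ _ := Set.ncard_union_le _ _
      _ ≤ 2 ^ I.card + 2 ^ I.card :=
          Nat.add_le_add ih' ((Set.ncard_image_le (Set.toFinite _)).trans ih')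
      _ = _ := by rw [Finset.card_insert_of_notMem hi, pow_succ]; ring

/-- If `2c ≤ m`, the code of order `m - c` has a word of weight `2 ^ c` outside the code of order
`m - c - 1`. -/
theorem exists_word_of_weight [Fintype B] {c : ℕ} (hc : 2 * c ≤ Fintype.card B) :
    ∃ f ∈ coxeterCode cs ((Fintype.card B : ℤ) - c),
      f ∉ coxeterCode cs ((Fintype.card B : ℤ) - c - 1) ∧ hammingNorm f = 2 ^ c := by
  classical
  obtain ⟨I₀, -, hcard, hI₀⟩ := exists_commuting_subset cs Finset.univ
  rw [Finset.card_univ] at hcard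
  obtain ⟨I, hI, hIc⟩ := Finset.exists_subset_card_eq (show c ≤ I₀.card by omega)
  have hmem : cosetWord cs 1 I ∈ coxeterCode cs ((Fintype.card B : ℤ) - c) :=
    cosetWord_mem_of_card_eq cs (by omega)
  have hne : cosetWord cs 1 I ≠ 0 := by
    intro h
    have := congrFun h 1
    simp [cosetWord_apply] at this
  have hle : hammingNorm (cosetWord cs 1 I) ≤ 2 ^ c := by
    have h := ncard_standardSubgroup_le cs I fun i hi j hj => hI₀ i (hI hi) j (hI hj)
    rw [hIc] at h
    refine le_trans (le_of_eq ?_) h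
    rw [hammingNorm, ← Set.ncard_coe_finset]
    congr 1
    ext w
    simp [cosetWord_apply]
  have hcB : c ≤ Fintype.card B := by omega
  refine ⟨_, hmem, fun h => ?_, le_antisymm hle ?_⟩
  -- Nonzero words of the smaller code have weight at least `2 ^ (c + 1)`.
  · have hlow := two_pow_le_hammingNorm cs (by
      rcases Nat.eq_zero_or_pos c with h0 | h0 <;> omega) h hne
    rw [show ((Fintype.card B : ℤ) - (Fintype.card B - c - 1)).toNat = c + 1 by omega,
      pow_succ] at hlow
    have := Nat.two_pow_pos c
    omega
  · have hlow := two_pow_le_hammingNorm cs (by omega) hmem hne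
    rwa [show ((Fintype.card B : ℤ) - (Fintype.card B - c)).toNat = c by omega] at hlow

end Distance

/-! ### Pauli operators -/

section Pauli

variable {ι : Type*}

/-- A computational basis label of one qubit as an element of `𝔽₂`. -/
def bit : Fin 2 ≃ ZMod 2 := Equiv.refl _

/-- Computational basis labels as binary vectors. -/
def bits : (ι → Fin 2) ≃ (ι → ZMod 2) := Equiv.piCongrRight fun _ => bit

theorem bits_apply (a : ι → Fin 2) (i : ι) : bits a i = bit (a i) := rfl

theorem zmod_two_eq_zero_or_one (a : ZMod 2) : a = 0 ∨ a = 1 := by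
  revert a; decide

/-- The nontrivial character of `𝔽₂`. -/
noncomputable def sign (t : ZMod 2) : ℂ := if t = 0 then 1 else -1

@[simp] theorem sign_zero : sign 0 = 1 := if_pos rfl

theorem sign_one : sign 1 = -1 := if_neg one_ne_zero

theorem sign_add (s t : ZMod 2) : sign (s + t) = sign s * sign t := by
  rcases zmod_two_eq_zero_or_one s with rfl | rfl <;>
    rcases zmod_two_eq_zero_or_one t with rfl | rfl <;>
    simp [sign_one, CharTwo.add_self_eq_zero]

theorem sign_ne_zero (t : ZMod 2) : sign t ≠ 0 := by
  unfold sign; split_ifs <;> simp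

theorem sign_injective : Function.Injective sign := by
  intro s t h
  rcases zmod_two_eq_zero_or_one s with rfl | rfl <;>
    rcases zmod_two_eq_zero_or_one t with rfl | rfl <;>
    first
    | rfl
    | (simp only [sign_one, sign_zero] at h; norm_num at h)

theorem sign_sum {κ : Type*} (s : Finset κ) (f : κ → ZMod 2) :
    sign (∑ i ∈ s, f i) = ∏ i ∈ s, sign (f i) := by
  classical
  induction s using Finset.induction_on with
  | empty => simp
  | insert i s hi ih => rw [Finset.sum_insert hi, Finset.prod_insert hi, sign_add, ih]

theorem bit_zero : bit 0 = 0 := rfl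

theorem bit_one : bit 1 = 1 := rfl

theorem pauliX_pow_apply (x : ZMod 2) (a b : Fin 2) :
    (pauliX ^ x.val) a b = if bit a = bit b + x then 1 else 0 := by
  rcases zmod_two_eq_zero_or_one x with rfl | rfl <;> fin_cases a <;> fin_cases b <;>
    simp [pauliX, ZMod.val_one, bit_zero, bit_one, CharTwo.add_self_eq_zero]

theorem pauliZ_pow_apply (z : ZMod 2) (a b : Fin 2) :
    (pauliZ ^ z.val) a b = if a = b then sign (z * bit b) else 0 := by
  rcases zmod_two_eq_zero_or_one z with rfl | rfl <;> fin_cases a <;> fin_cases b <;>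
    simp [pauliZ, ZMod.val_one, bit_zero, bit_one, sign_one]

variable [Fintype ι]

theorem prod_ite_one_zero (p : ι → Prop) [DecidablePred p] [Decidable (∀ i, p i)] :
    (∏ i, if p i then (1 : ℂ) else 0) = if ∀ i, p i then 1 else 0 := by
  split_ifs with h
  · exact Finset.prod_eq_one fun i _ => if_pos (h i)
  · push Not at h
    obtain ⟨i, hi⟩ := h
    exact Finset.prod_eq_zero (Finset.mem_univ i) (if_neg hi)

theorem zOp_apply (z : ι → ZMod 2) (a b : ι → Fin 2) :
    zOp z a b = if a = b then sign (z ⬝ᵥ bits b) else 0 := by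
  simp only [zOp, tensorOp, Matrix.of_apply, pauliZ_pow_apply]
  split_ifs with h
  · subst h
    simp [dotProduct, sign_sum, bits_apply]
  · obtain ⟨i, hi⟩ := Function.ne_iff.mp h
    exact Finset.prod_eq_zero (Finset.mem_univ i) (if_neg hi)

theorem xOp_apply (x : ι → ZMod 2) (a b : ι → Fin 2) :
    xOp x a b = if bits a = bits b + x then 1 else 0 := by
  simp only [xOp, tensorOp, Matrix.of_apply, pauliX_pow_apply, funext_iff, Pi.add_apply, bits_apply]
  exact prod_ite_one_zero _

variable [DecidableEq ι]

theorem pauli_apply (x z : ι → ZMod 2) (a b : ι → Fin 2) :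
    pauli x z a b = if bits a = bits b + x then sign (z ⬝ᵥ bits b) else 0 := by
  rw [pauli, Matrix.mul_apply, Finset.sum_eq_single b]
  · rw [xOp_apply, zOp_apply, if_pos rfl]
    split_ifs <;> simp
  · intro c _ hc
    rw [zOp_apply, if_neg hc, mul_zero]
  · simp

theorem xOp_eq_pauli (x : ι → ZMod 2) : xOp x = pauli x 0 := by
  ext a b
  rw [xOp_apply, pauli_apply]
  simp

theorem zOp_eq_pauli (z : ι → ZMod 2) : zOp z = pauli 0 z := by
  ext a b
  rw [zOp_apply, pauli_apply]
  simp [bits.injective.eq_iff]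

theorem pauli_zero : pauli (0 : ι → ZMod 2) 0 = 1 := by
  ext a b
  rw [pauli_apply, Matrix.one_apply]
  simp [bits.injective.eq_iff]

theorem pauli_mul (x z x' z' : ι → ZMod 2) :
    pauli x z * pauli x' z' = sign (z ⬝ᵥ x') • pauli (x + x') (z + z') := by
  ext a b
  rw [Matrix.mul_apply, Finset.sum_eq_single (bits.symm (bits b + x'))]
  · rw [Matrix.smul_apply, pauli_apply, pauli_apply, pauli_apply, Equiv.apply_symm_apply,
      if_pos rfl, show bits b + (x + x') = bits b + x' + x by abel, dotProduct_add, add_dotProduct,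
      sign_add, sign_add, smul_eq_mul]
    split_ifs <;> ring
  · intro c _ hc
    rw [pauli_apply x' z', if_neg, mul_zero]
    intro h
    exact hc (by rw [← h, Equiv.symm_apply_apply])
  · simp

theorem pauli_mulVec (x z : ι → ZMod 2) (ψ : (ι → Fin 2) → ℂ) (b : ι → ZMod 2) :
    (pauli x z).mulVec ψ (bits.symm (b + x)) = sign (z ⬝ᵥ b) * ψ (bits.symm b) := by
  rw [Matrix.mulVec, dotProduct, Finset.sum_eq_single (bits.symm b)]
  · rw [pauli_apply, Equiv.apply_symm_apply, Equiv.apply_symm_apply, if_pos rfl]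
  · intro c _ hc
    rw [pauli_apply, if_neg, zero_mul]
    intro h
    rw [Equiv.apply_symm_apply, add_left_inj] at h
    exact hc (by rw [h, Equiv.symm_apply_apply])
  · simp

/-- The column at `0` reveals `x` and the scalar; the columns at the unit vectors then reveal `z`.
-/
theorem smul_pauli_eq {c c' : ℂ} (hc : c ≠ 0) {x z x' z' : ι → ZMod 2}
    (h : c • pauli x z = c' • pauli x' z') : x = x' ∧ z = z' ∧ c = c' := by
  have hentry (a b : ι → ZMod 2) : c * (if a = b + x then sign (z ⬝ᵥ b) else 0) =
      c' * (if a = b + x' then sign (z' ⬝ᵥ b) else 0) := by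
    have := congrFun (congrFun h (bits.symm a)) (bits.symm b)
    simpa [pauli_apply] using this
  have hx : x = x' := by
    by_contra hne
    have := hentry (0 + x) 0
    rw [if_pos rfl, if_neg (fun h => hne (add_left_cancel h)), dotProduct_zero, sign_zero] at this
    simp [hc] at this
  subst hx
  have hcc : c = c' := by
    have := hentry (0 + x) 0
    simpa using this
  subst hcc
  refine ⟨rfl, ?_, rfl⟩
  funext i
  have := hentry (Pi.single i 1 + x) (Pi.single i 1)
  rw [if_pos rfl, if_pos rfl] at this
  have := sign_injective (mul_left_cancel₀ hc this)
  simpa using this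

theorem pauli_commute_iff (x z x' z' : ι → ZMod 2) :
    Commute (pauli x z) (pauli x' z') ↔ z ⬝ᵥ x' = z' ⬝ᵥ x := by
  rw [Commute, SemiconjBy, pauli_mul, pauli_mul, add_comm x' x, add_comm z' z]
  constructor
  · intro h
    exact sign_injective (smul_pauli_eq (sign_ne_zero _) h).2.2
  · intro h
    rw [h]

end Pauli

/-! ### CSS codes -/

section CSS

variable {ι : Type*} [Fintype ι] [DecidableEq ι] {C₁ C₂ : Submodule (ZMod 2) (ι → ZMod 2)}

/-- The inclusion makes `Z^z` commute with `X^x`, so products of generators never acquire a sign. -/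
theorem mem_css_iff (h : dualCode C₁ ≤ C₂) {s : Op ι} :
    s ∈ css C₁ C₂ ↔ ∃ x ∈ dualCode C₁, ∃ z ∈ dualCode C₂, s = pauli x z := by
  constructor
  · intro hs
    induction hs using Submonoid.closure_induction with
    | mem s hs =>
      rcases hs with ⟨x, hx, rfl⟩ | ⟨z, hz, rfl⟩
      · exact ⟨x, hx, 0, zero_mem _, xOp_eq_pauli x⟩
      · exact ⟨0, zero_mem _, z, hz, zOp_eq_pauli z⟩
    | one => exact ⟨0, zero_mem _, 0, zero_mem _, pauli_zero.symm⟩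
    | mul s t _ _ hs ht =>
      obtain ⟨x, hx, z, hz, rfl⟩ := hs
      obtain ⟨x', hx', z', hz', rfl⟩ := ht
      refine ⟨x + x', add_mem hx hx', z + z', add_mem hz hz', ?_⟩
      rw [pauli_mul, dotProduct_comm, hz x' (h hx'), sign_zero, one_smul]
  · rintro ⟨x, hx, z, hz, rfl⟩
    exact mul_mem (Submonoid.subset_closure (Or.inl ⟨x, hx, rfl⟩))
      (Submonoid.subset_closure (Or.inr ⟨z, hz, rfl⟩))

theorem css_isStabilizerGroup (h : dualCode C₁ ≤ C₂) : IsStabilizerGroup (css C₁ C₂) where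
  isPauli s hs := by
    obtain ⟨x, -, z, -, rfl⟩ := (mem_css_iff h).mp hs
    exact ⟨1, x, z, one_pow 4, (one_smul _ _).symm⟩
  commute s hs t ht := by
    obtain ⟨x, hx, z, hz, rfl⟩ := (mem_css_iff h).mp hs
    obtain ⟨x', hx', z', hz', rfl⟩ := (mem_css_iff h).mp ht
    rw [pauli_commute_iff, dotProduct_comm, hz x' (h hx'), dotProduct_comm, hz' x (h hx)]
  neg_one_notMem hs := by
    obtain ⟨x, -, z, -, hxz⟩ := (mem_css_iff h).mp hs
    have h1 : (-1 : ℂ) • pauli (0 : ι → ZMod 2) 0 = (1 : ℂ) • pauli x z := by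
      rw [pauli_zero, one_smul, ← hxz, neg_one_smul]
    have := (smul_pauli_eq (by norm_num) h1).2.2
    norm_num at this

theorem mem_logicalWeights_css_iff (h : dualCode C₁ ≤ C₂) {w : ℕ} :
    w ∈ logicalWeights (css C₁ C₂) ↔ ∃ x ∈ C₂, ∃ z ∈ C₁,
      (x ∉ dualCode C₁ ∨ z ∉ dualCode C₂) ∧ w = pauliWeight x z := by
  have hcomm (x z : ι → ZMod 2) :
      (∀ s ∈ css C₁ C₂, Commute s (pauli x z)) ↔ x ∈ C₂ ∧ z ∈ C₁ := by
    constructor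
    · intro hs
      constructor
      · rw [← dualCode_dualCode C₂]
        intro d hd
        have := hs _ ((mem_css_iff h).mpr ⟨0, zero_mem _, d, hd, rfl⟩)
        rw [pauli_commute_iff] at this
        simpa using this
      · rw [← dualCode_dualCode C₁]
        intro a ha
        have := hs _ ((mem_css_iff h).mpr ⟨a, ha, 0, zero_mem _, rfl⟩)
        rw [pauli_commute_iff] at this
        rw [dotProduct_comm]
        simpa using this.symm
    · rintro ⟨hx, hz⟩ s hs
      obtain ⟨a, ha, d, hd, rfl⟩ := (mem_css_iff h).mp hs
      rw [pauli_commute_iff, dotProduct_comm, hd x hx, ha z hz]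
  have hmem (x z : ι → ZMod 2) :
      (∀ c : ℂ, c • pauli x z ∉ css C₁ C₂) ↔ x ∉ dualCode C₁ ∨ z ∉ dualCode C₂ := by
    rw [← not_iff_not]
    push Not
    constructor
    · rintro ⟨c, hc⟩
      obtain ⟨a, ha, d, hd, hcd⟩ := (mem_css_iff h).mp hc
      have h1 : (1 : ℂ) • pauli a d = c • pauli x z := by rw [one_smul, hcd]
      obtain ⟨rfl, rfl, -⟩ := smul_pauli_eq one_ne_zero h1
      exact ⟨ha, hd⟩
    · rintro ⟨hx, hz⟩
      exact ⟨1, by rw [one_smul]; exact (mem_css_iff h).mpr ⟨x, hx, z, hz, rfl⟩⟩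
  simp only [logicalWeights, Set.mem_ofPred_eq, hcomm, hmem]
  constructor
  · rintro ⟨x, z, ⟨hx, hz⟩, hn, rfl⟩
    exact ⟨x, hx, z, hz, hn, rfl⟩
  · rintro ⟨x, hx, z, hz, hn, rfl⟩
    exact ⟨x, z, ⟨hx, hz⟩, hn, rfl⟩

/-- The `X` stabilizers act by translation along `C₁^⊥`; the `Z` stabilizers are diagonal, and some
one of them negates any basis state outside `C₂ = C₂^⊥^⊥`. -/
theorem mem_codeSpace_css_iff (h : dualCode C₁ ≤ C₂) {ψ : (ι → Fin 2) → ℂ} :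
    ψ ∈ codeSpace (css C₁ C₂) ↔
      (∀ b, ∀ x ∈ dualCode C₁, ψ (bits.symm (b + x)) = ψ (bits.symm b)) ∧
        ∀ b, b ∉ C₂ → ψ (bits.symm b) = 0 := by
  constructor
  · intro hψ
    constructor
    · intro b x hx
      have := congrFun (hψ _ ((mem_css_iff h).mpr ⟨x, hx, 0, zero_mem _, rfl⟩)) (bits.symm (b + x))
      rw [pauli_mulVec, zero_dotProduct, sign_zero, one_mul] at this
      exact this.symm
    · intro b hb
      rw [← dualCode_dualCode C₂, mem_dualCode] at hb
      push Not at hb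
      obtain ⟨z, hz, hzb⟩ := hb
      have := congrFun (hψ _ ((mem_css_iff h).mpr ⟨0, zero_mem _, z, hz, rfl⟩)) (bits.symm (b + 0))
      rw [pauli_mulVec, add_zero, zmod_two_eq_one_of_ne_zero hzb, sign_one] at this
      linear_combination -(1 / 2 : ℂ) * this
  · rintro ⟨hinv, hsupp⟩ s hs
    obtain ⟨x, hx, z, hz, rfl⟩ := (mem_css_iff h).mp hs
    funext a
    obtain ⟨b, rfl⟩ : ∃ b, a = bits.symm (b + x) := ⟨bits a - x, by simp⟩
    rw [pauli_mulVec, hinv b x hx]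
    by_cases hb : b ∈ C₂
    · rw [dotProduct_comm, hz b hb, sign_zero, one_mul]
    · rw [hsupp b hb, mul_zero]

/-- The code space of a CSS code is the space of functions on the classes of `C₂` modulo
`C₁^⊥`. -/
noncomputable def codeSpaceEquiv (h : dualCode C₁ ≤ C₂) :
    codeSpace (css C₁ C₂) ≃ₗ[ℂ] ((C₂ ⧸ (dualCode C₁).submoduleOf C₂) → ℂ) := by
  classical
  exact
  { toFun := fun ψ q => ψ.1 (bits.symm (q.out : C₂))
    map_add' := fun _ _ => rfl
    map_smul' := fun _ _ => rfl
    invFun := fun φ => ⟨fun a => if ha : bits a ∈ C₂ then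
        φ (Submodule.Quotient.mk ⟨bits a, ha⟩) else 0, by
      rw [mem_codeSpace_css_iff h]
      constructor
      · intro b x hx
        simp only [Equiv.apply_symm_apply]
        by_cases hb : b ∈ C₂
        · rw [dif_pos hb, dif_pos (add_mem hb (h hx))]
          congr 1
          rw [Submodule.Quotient.eq]
          simpa [Submodule.submoduleOf] using hx
        · rw [dif_neg hb, dif_neg]
          intro hbx
          exact hb (by simpa using sub_mem hbx (h hx))
      · intro b hb
        simp [hb]⟩
    left_inv := by
      rintro ⟨ψ, hψ⟩
      obtain ⟨hinv, hsupp⟩ := (mem_codeSpace_css_iff h).mp hψ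
      refine Subtype.ext (funext fun a => ?_)
      obtain ⟨b, rfl⟩ := bits.symm.surjective a
      simp only [Equiv.apply_symm_apply]
      split_ifs with hb
      · set c := Quotient.out (Submodule.Quotient.mk ⟨b, hb⟩ :
          C₂ ⧸ (dualCode C₁).submoduleOf C₂) with hc
        have hq : (Submodule.Quotient.mk c : C₂ ⧸ (dualCode C₁).submoduleOf C₂) =
            Submodule.Quotient.mk ⟨b, hb⟩ := Quotient.out_eq _
        rw [Submodule.Quotient.eq] at hq
        have hx : (c : ι → ZMod 2) - b ∈ dualCode C₁ := hq
        have := hinv b _ hx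
        rwa [add_sub_cancel] at this
      · exact (hsupp b hb).symm
    right_inv := by
      intro φ
      funext q
      simp only [Equiv.apply_symm_apply]
      rw [dif_pos (Quotient.out q).2]
      exact congrArg φ (Quotient.out_eq q) }

theorem finrank_codeSpace_css (h : dualCode C₁ ≤ C₂) :
    Module.finrank ℂ (codeSpace (css C₁ C₂)) =
      2 ^ (Module.finrank (ZMod 2) C₂ - Module.finrank (ZMod 2) (dualCode C₁)) := by
  classical
  have := Fintype.ofFinite (C₂ ⧸ (dualCode C₁).submoduleOf C₂)
  rw [(codeSpaceEquiv h).finrank_eq, Module.finrank_fintype_fun_eq_card,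
    Module.card_eq_pow_finrank (K := ZMod 2), ZMod.card]
  congr 1
  have h1 := Submodule.finrank_quotient_add_finrank ((dualCode C₁).submoduleOf C₂)
  have h2 := (Submodule.submoduleOfEquivOfLe h).finrank_eq
  omega

end CSS

end QCoxeter

/-! ### Parameters and distance of the quantum Coxeter code -/

theorem mainTheorem9 {B W : Type*} [Fintype B] [Group W] [Fintype W] [DecidableEq W]
    {M : CoxeterMatrix B} (cs : CoxeterSystem M W) (q r : ℤ)
    (hq : -1 ≤ q) (hqr : q ≤ r) (hr : r ≤ (Fintype.card B : ℤ)) :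
    QCoxeter.dualCode (QCoxeter.coxeterCode cs ((Fintype.card B : ℤ) - q - 1)) ≤
        QCoxeter.coxeterCode cs r ∧
      QCoxeter.IsCode (QCoxeter.quantumCoxeter cs q r) (Fintype.card W)
        (∑ i ∈ Finset.Icc (q + 1) r, QCoxeter.eulerian cs i.toNat) ∧
      (q < r → QCoxeter.HasDistance (QCoxeter.quantumCoxeter cs q r)
        (2 ^ (min (q + 1) ((Fintype.card B : ℤ) - r)).toNat)) := by
  open QCoxeter in
  have hd1 : dualCode (coxeterCode cs ((Fintype.card B : ℤ) - q - 1)) = coxeterCode cs q := by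
    rw [dualCode_coxeterCode cs (by omega) (by omega)]
    congr 1; ring
  have hd2 := dualCode_coxeterCode cs (hq.trans hqr) hr
  have hle : dualCode (coxeterCode cs ((Fintype.card B : ℤ) - q - 1)) ≤ coxeterCode cs r := by
    rw [hd1]; exact coxeterCode_mono cs hqr hr
  refine ⟨hle, ⟨css_isStabilizerGroup hle, rfl, ?_⟩, fun hlt => ⟨?_, ?_⟩⟩
  · rw [quantumCoxeter, finrank_codeSpace_css hle, hd1, finrank_sub_eq_sum cs hq hqr hr]
  · rw [quantumCoxeter, mem_logicalWeights_css_iff hle, hd1, hd2]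
    -- The smaller of `q + 1` and `m - r` is at most `m/2`, as their sum is at most `m - 1 + 1 = m`
    -- when `q < r`. The light word is used as a `Z` operator when `q + 1` is the minimum and as an
    -- `X` operator otherwise; `q < r` also puts the relevant stabilizer code inside the code which
    -- that word avoids.
    rcases le_total (q + 1) ((Fintype.card B : ℤ) - r) with hmin | hmin
    · rw [min_eq_left hmin]
      obtain ⟨f, hf, hfn, hfw⟩ := exists_word_of_weight cs
        (c := (q + 1).toNat) (by omega)
      refine ⟨0, zero_mem _, f, ?_, Or.inr fun h => hfn ?_, ?_⟩
      · convert hf using 2; omega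
      · exact coxeterCode_mono cs (by omega) (by omega) h
      · rw [← hfw]; simp [pauliWeight, hammingNorm]
    · rw [min_eq_right hmin]
      obtain ⟨f, hf, hfn, hfw⟩ := exists_word_of_weight cs
        (c := ((Fintype.card B : ℤ) - r).toNat) (by omega)
      refine ⟨f, ?_, 0, zero_mem _, Or.inl fun h => hfn ?_, ?_⟩
      · convert hf using 2; omega
      · exact coxeterCode_mono cs (by omega) (by omega) h
      · rw [← hfw]; simp [pauliWeight, hammingNorm]
  · intro w hw
    rw [quantumCoxeter, mem_logicalWeights_css_iff hle, hd1, hd2] at hw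
    obtain ⟨x, hx, z, hz, hn, rfl⟩ := hw
    rcases hn with hn | hn
    · have h0 : x ≠ 0 := fun h => hn (h ▸ zero_mem _)
      calc 2 ^ (min (q + 1) ((Fintype.card B : ℤ) - r)).toNat
          ≤ 2 ^ ((Fintype.card B : ℤ) - r).toNat := Nat.pow_le_pow_right two_pos (by omega)
        _ ≤ hammingNorm x := two_pow_le_hammingNorm cs (hq.trans hqr) hx h0
        _ ≤ pauliWeight x z := Finset.card_le_card
            (Finset.monotone_filter_right _ fun i _ hi => Or.inl hi)
    · have h0 : z ≠ 0 := fun h => hn (h ▸ zero_mem _)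
      calc 2 ^ (min (q + 1) ((Fintype.card B : ℤ) - r)).toNat
          ≤ 2 ^ ((Fintype.card B : ℤ) - (Fintype.card B - q - 1)).toNat :=
            Nat.pow_le_pow_right two_pos (by omega)
        _ ≤ hammingNorm z := two_pow_le_hammingNorm cs (by omega) hz h0
        _ ≤ pauliWeight x z := Finset.card_le_card
            (Finset.monotone_filter_right _ fun i _ hi => Or.inr hi)
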